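/- Let $G$ be a finite simple connected graph with $n\ge 1$ vertices, one of which, $v$, initially knows a rumour. When a vertex $x$ calls a vertex $y$ and exactly one of them knows the rumour, the other one learns it. *Asynchronous protocol:* the vertices carry independent Poisson clocks of rate $1$, and whenever the clock of $x$ rings, $x$ calls a uniformly random neighbour, independently of everything else. *Synchronous protocol:* in each of the rounds $1,2,\dots$ all vertices simultaneously call independent uniformly random neighbours (a vertex that learns the rumour in a round cannot pass it on in the same round). If $n=1$, no calls are made. Let $\mathrm{ST}_a(G,v)$ and $\mathrm{ST}_s(G,v)$ be the first time (respectively, the first round) at which all vertices know the rumour. For $*\in\{a,s\}$, let the average spread time $\mathrm{wast}_*(G)$ be the smallest $t$ with $\mathbb E[\mathrm{ST}_*(G,v)]\le t$ for every vertex $v$, and let the guaranteed spread time $\mathrm{gst}_*(G)$ be the smallest $t\ge 0$ with $\mathbb P(\mathrm{ST}_*(G,v)>t)\le 1/n$ for every vertex $v$. Let $H_n=\sum_{i=1}^n 1/i$. **Theorem.** For every such $G$, $$\mathrm{wast}_a(G)\le H_n\,\mathrm{wast}_s(G)\qquad\text{and}\qquad \mathrm{gst}_a(G)\le 8\,\mathrm{gst}_s(G)\,\log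 n .$$ Both bounds are best possible up to constant factors: there is a constant $c>0$ such that for every $n\ge 2$ the star $S_n$ with $n$ vertices satisfies $$\mathrm{wast}_a(S_n)\ge c\,H_n\,\mathrm{wast}_s(S_n)\qquad\text{and}\qquad \mathrm{gst}_a(S_n)\ge c\,\mathrm{gst}_s(S_n)\,\log n .$$ -/

import Mathlib

open MeasureTheory ProbabilityTheory
open scoped ENNReal NNReal

namespace RumourSpreading

/-- The exponential distribution of rate 1 is a probability measure. -/
instance isProbabilityMeasure_exp_one : IsProbabilityMeasure (expMeasure 1) :=
  isProbabilityMeasure_expMeasure one_pos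

section Calls

variable {V : Type*} [Fintype V]

open Classical in
/-- The law of the vertex called by `x`: a uniformly random neighbour of `x`. An isolated vertex
has nobody to call; by convention it calls itself, which has no effect. -/
noncomputable def callLaw (G : SimpleGraph V) (x : V) : PMF V :=
  if h : (Finset.univ.filter fun y => G.Adj x y).Nonempty then
    PMF.uniformOfFinset (Finset.univ.filter fun y => G.Adj x y) h
  else PMF.pure x

/-- The law of the calling lists: the entry `(x, k)` is the vertex called by `x` at its call
number `k` (counted from 0); all entries are independent, and every entry of the list of `x` is a
uniformly random neighbour of `x`. -/
noncomputable def callListLaw [MeasurableSpace V] (G : SimpleGraph V) : Measure (V × ℕ → V) :=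
  Measure.infinitePi fun p : V × ℕ => (callLaw G p.1).toMeasure

end Calls

/-- The law of the waiting times of the clocks: the entry `(x, k)` is the time between the rings
number `k - 1` and `k` of the clock of `x` (the time up to the first ring if `k = 0`); all entries
are independent and exponential of rate 1. -/
noncomputable def clockLaw (V : Type*) : Measure (V × ℕ → ℝ) :=
  Measure.infinitePi fun _ : V × ℕ => expMeasure 1

/-- The time at which the clock of `x` rings for the time number `k` (counted from 0). -/
noncomputable def ringTime {V : Type*} (w : V × ℕ → ℝ) (x : V) (k : ℕ) : ℝ :=
  ∑ i ∈ Finset.range (k + 1), w (x, i)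

/-! ### The asynchronous protocol -/

/-- `AsyncKnows w c v u t`: with waiting times `w`, calling lists `c` and the rumour starting at
`v` at time 0, the vertex `u` knows the rumour at time `t`. When the clock of `x` rings for the
time number `k`, it calls `c (x, k)`; if one of these two vertices knew the rumour strictly before
that moment, then both know it from that moment on. -/
inductive AsyncKnows {V : Type*} (w : V × ℕ → ℝ) (c : V × ℕ → V) (v : V) : V → ℝ → Prop
  | source {t : ℝ} : 0 ≤ t → AsyncKnows w c v v t
  | push {x : V} {k : ℕ} {r t : ℝ} : AsyncKnows w c v x r → r < ringTime w x k →
      ringTime w x k ≤ t → AsyncKnows w c v (c (x, k)) t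
  | pull {x : V} {k : ℕ} {r t : ℝ} : AsyncKnows w c v (c (x, k)) r → r < ringTime w x k →
      ringTime w x k ≤ t → AsyncKnows w c v x t

/-- The asynchronous spread time from `v`: the first time at which all vertices know the rumour
(`⊤` if there is none). -/
noncomputable def asyncSpreadTime {V : Type*} (v : V) (ω : (V × ℕ → ℝ) × (V × ℕ → V)) : ℝ≥0∞ :=
  ⨅ (t : ℝ≥0) (_ : ∀ u, AsyncKnows ω.1 ω.2 v u t), (t : ℝ≥0∞)

/-- The law of the randomness of the asynchronous protocol: clocks and calling lists are
independent. -/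
noncomputable def asyncLaw {V : Type*} [Fintype V] [MeasurableSpace V] (G : SimpleGraph V) :
    Measure ((V × ℕ → ℝ) × (V × ℕ → V)) :=
  (clockLaw V).prod (callListLaw G)

/-! ### The synchronous protocol -/

/-- The set of vertices knowing the rumour after `k` rounds, if it starts at `v` and in round
`k + 1` every vertex `x` calls `c (x, k)`. -/
def syncInformed {V : Type*} (c : V × ℕ → V) (v : V) : ℕ → Set V
  | 0 => {v}
  | k + 1 => {u | u ∈ syncInformed c v k ∨ (∃ x ∈ syncInformed c v k, c (x, k) = u) ∨
      c (u, k) ∈ syncInformed c v k}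

/-- The synchronous spread time from `v`: the first round after which all vertices know the rumour
(`⊤` if there is none). -/
noncomputable def syncSpreadTime {V : Type*} (v : V) (c : V × ℕ → V) : ℝ≥0∞ :=
  ⨅ (k : ℕ) (_ : ∀ u, u ∈ syncInformed c v k), (k : ℝ≥0∞)

/-! ### Average and guaranteed spread times -/

section SpreadTimes

variable {V : Type*} [Fintype V] [MeasurableSpace V]

/-- The smallest `t` such that the expected asynchronous spread time is at most `t` from every
starting vertex. -/
noncomputable def asyncAverage (G : SimpleGraph V) : ℝ≥0∞ :=
  sInf {t : ℝ≥0∞ | ∀ v : V, ∫⁻ ω, asyncSpreadTime v ω ∂(asyncLaw G) ≤ t}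

/-- The smallest `t` such that the asynchronous spread time exceeds `t` with probability at most
`1 / n` from every starting vertex, `n` being the number of vertices. -/
noncomputable def asyncGuaranteed (G : SimpleGraph V) : ℝ≥0∞ :=
  sInf {t : ℝ≥0∞ | ∀ v : V, asyncLaw G {ω | t < asyncSpreadTime v ω} ≤ 1 / (Fintype.card V : ℝ≥0∞)}

/-- The smallest `t` such that the expected synchronous spread time is at most `t` from every
starting vertex. -/
noncomputable def syncAverage (G : SimpleGraph V) : ℝ≥0∞ :=
  sInf {t : ℝ≥0∞ | ∀ v : V, ∫⁻ c, syncSpreadTime v c ∂(callListLaw G) ≤ t}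

/-- The smallest `t` such that the synchronous spread time exceeds `t` with probability at most
`1 / n` from every starting vertex, `n` being the number of vertices. -/
noncomputable def syncGuaranteed (G : SimpleGraph V) : ℝ≥0∞ :=
  sInf {t : ℝ≥0∞ | ∀ v : V,
    callListLaw G {c | t < syncSpreadTime v c} ≤ 1 / (Fintype.card V : ℝ≥0∞)}

end SpreadTimes

/-- The harmonic number `1 + 1/2 + ⋯ + 1/n` as an extended nonnegative real. -/
noncomputable def H (n : ℕ) : ℝ≥0∞ := ENNReal.ofReal (harmonic n : ℝ)

/-- The natural logarithm of `n` as an extended nonnegative real (`0` for `n = 0`). -/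
noncomputable def logN (n : ℕ) : ℝ≥0∞ := ENNReal.ofReal (Real.log n)

/-- The star with `n + 1` vertices: the vertex `0` is adjacent to all the others, and there are no
other edges. -/
def starOn (n : ℕ) : SimpleGraph (Fin (n + 1)) := SimpleGraph.starGraph 0

end RumourSpreading

/-!
Upper bounds. Cut time into phases: a phase lasts until every clock has rung since its start. Let
the first call of each vertex in phase `k` be its call in round `k` of a synchronous process. A
vertex informed in that process after `k` rounds is informed asynchronously at the end of phase `k`
(`asyncKnows_phaseEnd`). Two facts make this coupling useful.

* For given clocks, the calls used form an injective reindexing of the calling lists, so that they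
  are again independent uniform neighbours, independent of the clocks
  (`measurePreserving_phaseCalls`).
* At the end of a phase the clocks start afresh, independently of its length
  (`measurePreserving_phase`, which rests on the memorylessness of a single clock,
  `measurePreserving_residual`). So the phase lengths are independent maxima of `n` exponential
  variables, which have mean `H n`.

Hence the mean asynchronous spread time is at most `H n` times the synchronous one. For the
guaranteed spread times, if `k` rounds fail with probability at most `1 / n`, then `2 * k` rounds
fail with probability at most `1 / n ^ 2`, and the exponential moment of order `3 / 4` of the phase
lengths shows that `2 * k` phases exceed `8 * k * log n` with probability at most
`(16 / n ^ 4) ^ k`. For `n ≥ 3` these two probabilities add up to at most `1 / n`; for `n = 2` one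
round always suffices.

Lower bounds. On the star two synchronous rounds suffice. Asynchronously, with the rumour starting
at the centre, a leaf whose clock stays silent must be called by the centre, whose clock has rate 1
only. The centre and one leaf both stay silent up to time `t` with probability `exp (-2 * t)`,
which exceeds `1 / (n + 1)` for `t < log (n + 1) / 2`. Moreover, up to time `log (n + 1) / 4` it is
unlikely that the centre rings more than `n / 2` times, and likely that some leaf missed by its
first `n / 2` calls stays silent, so that the mean spread time is of order `log n`.
-/

namespace RumourSpreading

/-! ### Sequences of waiting times -/

/-- The law of the waiting times of a single clock. -/
noncomputable def waitLaw : Measure (ℕ → ℝ) := Measure.infinitePi fun _ => expMeasure 1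

instance : IsProbabilityMeasure waitLaw := by unfold waitLaw; infer_instance

/-- The sequence with first entry `a` and remaining entries `u`. -/
def consSeq (a : ℝ) (u : ℕ → ℝ) : ℕ → ℝ
  | 0 => a
  | i + 1 => u i

@[simp] lemma consSeq_zero (a : ℝ) (u : ℕ → ℝ) : consSeq a u 0 = a := rfl
@[simp] lemma consSeq_succ (a : ℝ) (u : ℕ → ℝ) (i : ℕ) : consSeq a u (i + 1) = u i := rfl

lemma measurable_consSeq : Measurable fun p : ℝ × (ℕ → ℝ) => consSeq p.1 p.2 := by
  refine measurable_pi_lambda _ fun i => ?_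
  cases i with
  | zero => exact measurable_fst
  | succ i => exact (measurable_pi_apply i).comp measurable_snd

lemma measurePreserving_consSeq :
    MeasurePreserving (fun p : ℝ × (ℕ → ℝ) => consSeq p.1 p.2)
      ((expMeasure 1).prod waitLaw) waitLaw := by
  refine ⟨measurable_consSeq, ?_⟩
  refine Measure.eq_infinitePi _ fun s t ht => ?_
  classical
  rw [Measure.map_apply measurable_consSeq (.pi s.countable_toSet fun i _ => ht i)]
  let t' : ℕ → Set ℝ := fun i => if i ∈ s then t i else Set.univ
  have ht' : ∀ i, MeasurableSet (t' i) := fun i => by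
    by_cases h : i ∈ s <;> simp [t', h, ht]
  obtain ⟨N, hN⟩ : ∃ N, s ⊆ Finset.range (N + 1) := by
    obtain ⟨N, hN⟩ := s.exists_nat_subset_range
    exact ⟨N, hN.trans (Finset.range_mono (Nat.le_succ N))⟩
  have h1 : (fun p : ℝ × (ℕ → ℝ) => consSeq p.1 p.2) ⁻¹' (Set.pi s t)
      = t' 0 ×ˢ Set.pi (Finset.range N) (fun i => t' (i + 1)) := by
    ext ⟨a, u⟩
    simp only [Set.mem_preimage, Set.mem_pi, Set.mem_prod, Finset.mem_coe, Finset.mem_range]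
    constructor
    · intro h
      refine ⟨?_, fun i _ => ?_⟩
      · by_cases h0 : 0 ∈ s
        · simpa [t', h0] using h 0 h0
        · simp [t', h0]
      · by_cases h0 : i + 1 ∈ s
        · simpa [t', h0] using h _ h0
        · simp [t', h0]
    · rintro ⟨h0, h1⟩ i hi
      cases i with
      | zero => simpa [t', hi] using h0
      | succ i =>
        have := h1 i (by have := hN hi; simp at this; omega)
        simpa [t', hi] using this
  rw [h1, Measure.prod_prod, waitLaw, Measure.infinitePi_pi _ (fun i _ => ht' _), mul_comm,
    ← Finset.prod_range_succ' (fun i => expMeasure 1 (t' i))]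
  rw [← Finset.prod_subset hN]
  · exact Finset.prod_congr rfl fun i hi => by simp [t', hi]
  · intro i _ hi
    simp [t', hi]

/-- The time at which a clock with waiting times `u` rings for the time number `k`. -/
noncomputable def seqRing (u : ℕ → ℝ) (k : ℕ) : ℝ := ∑ i ∈ Finset.range (k + 1), u i

lemma measurable_seqRing (k : ℕ) : Measurable fun u : ℕ → ℝ => seqRing u k := by
  unfold seqRing; fun_prop

@[simp] lemma seqRing_zero (u : ℕ → ℝ) : seqRing u 0 = u 0 := by simp [seqRing]

lemma seqRing_succ (u : ℕ → ℝ) (k : ℕ) : seqRing u (k + 1) = seqRing u k + u (k + 1) := by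
  rw [seqRing, Finset.sum_range_succ, seqRing]

lemma seqRing_consSeq_succ (a : ℝ) (u : ℕ → ℝ) (k : ℕ) :
    seqRing (consSeq a u) (k + 1) = a + seqRing u k := by
  rw [seqRing, Finset.sum_range_succ', add_comm]; rfl

lemma exists_ring_after (s : ℝ) (u : ℕ → ℝ) :
    ∃ m, (∃ m', s < seqRing u m') → s < seqRing u m := by
  by_cases h : ∃ m', s < seqRing u m'
  · exact ⟨h.choose, fun _ => h.choose_spec⟩
  · exact ⟨0, fun h' => absurd h' h⟩

open Classical in
/-- The number of rings up to time `s` of a clock with waiting times `u`; by convention it is `0`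
if the clock does not ring after time `s`. -/
noncomputable def ringCount (s : ℝ) (u : ℕ → ℝ) : ℕ := Nat.find (exists_ring_after s u)

open Classical in
/-- The waiting times of the clock with waiting times `u`, as seen by an observer who arrives at
time `s`. The constant sequence `0` stands for a clock which does not ring after time `s`. -/
noncomputable def residual (s : ℝ) (u : ℕ → ℝ) (i : ℕ) : ℝ :=
  if ∃ m, s < seqRing u m then
    if i = 0 then seqRing u (ringCount s u) - s else u (ringCount s u + i)
  else 0

lemma ringCount_spec {s : ℝ} {u : ℕ → ℝ} (h : ∃ m, s < seqRing u m) :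
    s < seqRing u (ringCount s u) := by
  classical
  exact Nat.find_spec (exists_ring_after s u) h

lemma seqRing_le_of_lt_ringCount {s : ℝ} {u : ℕ → ℝ} {m : ℕ} (h : m < ringCount s u) :
    seqRing u m ≤ s := by
  classical
  have := Nat.find_min (exists_ring_after s u) h
  push Not at this
  exact this.2

lemma ringCount_eq {s : ℝ} {u : ℕ → ℝ} {m : ℕ} (h : s < seqRing u m)
    (h' : ∀ i < m, seqRing u i ≤ s) : ringCount s u = m := by
  rcases lt_trichotomy (ringCount s u) m with h1 | h1 | h1
  · exact absurd (ringCount_spec ⟨m, h⟩) (not_lt.2 (h' _ h1))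
  · exact h1
  · exact absurd h (not_lt.2 (seqRing_le_of_lt_ringCount h1))

lemma residual_of_not_exists {s : ℝ} {u : ℕ → ℝ} (h : ¬ ∃ m, s < seqRing u m) :
    residual s u = 0 := by
  funext i; simp only [residual, if_neg h, Pi.zero_apply]

lemma residual_zero {s : ℝ} {u : ℕ → ℝ} (h : ∃ m, s < seqRing u m) :
    residual s u 0 = seqRing u (ringCount s u) - s := by
  simp only [residual, if_pos h, if_true]

lemma residual_succ {s : ℝ} {u : ℕ → ℝ} (h : ∃ m, s < seqRing u m) (i : ℕ) :
    residual s u (i + 1) = u (ringCount s u + (i + 1)) := by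
  simp only [residual, if_pos h, Nat.add_eq_zero_iff, one_ne_zero, and_false, if_false]

lemma seqRing_residual {s : ℝ} {u : ℕ → ℝ} (h : ∃ m, s < seqRing u m) (i : ℕ) :
    seqRing (residual s u) i = seqRing u (ringCount s u + i) - s := by
  induction i with
  | zero => simp [residual_zero h]
  | succ i ih => rw [seqRing_succ, ih, residual_succ h, ← add_assoc, seqRing_succ]; ring_nf

lemma residual_consSeq_of_lt {s a : ℝ} (h : s < a) (u : ℕ → ℝ) :
    residual s (consSeq a u) = consSeq (a - s) u := by
  have hex : ∃ m, s < seqRing (consSeq a u) m := ⟨0, by simpa using h⟩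
  have hc : ringCount s (consSeq a u) = 0 := ringCount_eq (by simpa using h) (by simp)
  funext i
  cases i with
  | zero => simp [residual_zero hex, hc]
  | succ i => simp [residual_succ hex, hc]

lemma residual_consSeq_of_le {s a : ℝ} (h : a ≤ s) (u : ℕ → ℝ) :
    residual s (consSeq a u) = residual (s - a) u := by
  by_cases hex : ∃ m, s - a < seqRing u m
  · have hex' : ∃ m, s < seqRing (consSeq a u) m := by
      obtain ⟨m, hm⟩ := hex
      exact ⟨m + 1, by rw [seqRing_consSeq_succ]; linarith⟩
    have hc : ringCount s (consSeq a u) = ringCount (s - a) u + 1 := by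
      refine ringCount_eq ?_ fun i hi => ?_
      · rw [seqRing_consSeq_succ]; linarith [ringCount_spec hex]
      · cases i with
        | zero => simpa using h
        | succ i =>
          rw [seqRing_consSeq_succ]
          linarith [seqRing_le_of_lt_ringCount (s := s - a) (u := u) (m := i) (by omega)]
    funext i
    cases i with
    | zero => rw [residual_zero hex, residual_zero hex', hc, seqRing_consSeq_succ]; ring
    | succ i =>
      rw [residual_succ hex, residual_succ hex', hc]
      rw [show ringCount (s - a) u + 1 + (i + 1) = (ringCount (s - a) u + (i + 1)) + 1 by ring]
      rfl
  · rw [residual_of_not_exists hex, residual_of_not_exists]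
    rintro ⟨m, hm⟩
    cases m with
    | zero => simp at hm; linarith
    | succ m => exact hex ⟨m, by rw [seqRing_consSeq_succ] at hm; linarith⟩

lemma measurableSet_exists_ring_after :
    MeasurableSet {p : ℝ × (ℕ → ℝ) | ∃ m, p.1 < seqRing p.2 m} := by
  rw [Set.ofPred_exists]
  exact .iUnion fun m => measurableSet_lt measurable_fst ((measurable_seqRing m).comp measurable_snd)

lemma measurable_ringCount : Measurable fun p : ℝ × (ℕ → ℝ) => ringCount p.1 p.2 := by
  classical
  refine measurable_find (fun p : ℝ × (ℕ → ℝ) => exists_ring_after p.1 p.2) fun k => ?_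
  simp only [imp_iff_not_or]
  exact measurableSet_exists_ring_after.compl.union
    (measurableSet_lt measurable_fst ((measurable_seqRing k).comp measurable_snd))

lemma measurable_residual : Measurable fun p : ℝ × (ℕ → ℝ) => residual p.1 p.2 := by
  classical
  refine measurable_pi_lambda _ fun i => ?_
  refine Measurable.ite measurableSet_exists_ring_after ?_ measurable_const
  have key : ∀ f : ℕ → (ℕ → ℝ) → ℝ, (∀ n, Measurable (f n)) →
      Measurable fun p : ℝ × (ℕ → ℝ) => f (ringCount p.1 p.2) p.2 := fun f hf => by
    have : Measurable fun q : (ℕ → ℝ) × ℕ => f q.2 q.1 := measurable_from_prod_countable_left hf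
    exact this.comp (measurable_snd.prodMk measurable_ringCount)
  by_cases hi : i = 0
  · simp only [hi, if_true]
    exact (key _ measurable_seqRing).sub measurable_fst
  · simp only [hi, if_false]
    exact key (fun n u => u (n + i)) fun n => measurable_pi_apply _

/-! ### The exponential distribution and its lack of memory -/

lemma lintegral_expMeasure_one {f : ℝ → ℝ≥0∞} (hf : Measurable f) :
    ∫⁻ x, f x ∂(expMeasure 1) = ∫⁻ x in Set.Ioi 0, ENNReal.ofReal (Real.exp (-x)) * f x := by
  have h1 : expMeasure 1 = volume.withDensity (exponentialPDF 1) := rfl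
  have hm : Measurable (exponentialPDF 1) := by unfold exponentialPDF; fun_prop
  rw [h1, lintegral_withDensity_eq_lintegral_mul _ hm hf,
    ← lintegral_indicator measurableSet_Ioi]
  refine lintegral_congr_ae ?_
  have h0 : ∀ᵐ x : ℝ, x ≠ 0 := by simp [ae_iff]
  filter_upwards [h0] with x hx
  rw [Pi.mul_apply, exponentialPDF_eq]
  by_cases h : 0 < x
  · simp [h, h.le]
  · have : ¬ 0 ≤ x := fun h' => h (lt_of_le_of_ne h' hx.symm)
    simp [h, this]

lemma expMeasure_one_Iic {t : ℝ} (ht : 0 ≤ t) :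
    expMeasure 1 (Set.Iic t) = ENNReal.ofReal (1 - Real.exp (-t)) := by
  have h := cdf_expMeasure_eq one_pos t
  rw [cdf_eq_real, if_pos ht, one_mul] at h
  rw [← h, ofReal_measureReal]

lemma expMeasure_one_Ioi {t : ℝ} (ht : 0 ≤ t) :
    expMeasure 1 (Set.Ioi t) = ENNReal.ofReal (Real.exp (-t)) := by
  rw [← Set.compl_Iic, prob_compl_eq_one_sub measurableSet_Iic, expMeasure_one_Iic ht,
    ← ENNReal.ofReal_one, ← ENNReal.ofReal_sub _ (by simpa using ht)]
  simp

lemma ae_expMeasure_one_pos : ∀ᵐ x ∂(expMeasure 1), 0 < x := by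
  have : expMeasure 1 (Set.Iic 0) = 0 := by rw [expMeasure_one_Iic le_rfl]; simp
  simpa [ae_iff, Set.Iic] using this

/-- Lack of memory of the exponential distribution. -/
lemma setLIntegral_Ioi_expMeasure_one {f : ℝ → ℝ≥0∞} (hf : Measurable f) {s : ℝ} (hs : 0 ≤ s) :
    ∫⁻ a in Set.Ioi s, f (a - s) ∂(expMeasure 1)
      = ENNReal.ofReal (Real.exp (-s)) * ∫⁻ a, f a ∂(expMeasure 1) := by
  have hfs : Measurable fun a : ℝ => f (a - s) := hf.comp (measurable_id.sub_const s)
  have hef : Measurable fun a : ℝ => ENNReal.ofReal (Real.exp (-a)) * f a :=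
    Measurable.mul (by fun_prop) hf
  rw [← lintegral_indicator measurableSet_Ioi,
    lintegral_expMeasure_one (hfs.indicator measurableSet_Ioi), lintegral_expMeasure_one hf,
    ← lintegral_indicator measurableSet_Ioi, ← lintegral_indicator measurableSet_Ioi,
    ← lintegral_const_mul _ (hef.indicator measurableSet_Ioi),
    ← lintegral_sub_right_eq_self (fun a => ENNReal.ofReal (Real.exp (-s)) *
      (Set.Ioi 0).indicator (fun x => ENNReal.ofReal (Real.exp (-x)) * f x) a) s]
  refine lintegral_congr fun a => ?_
  by_cases h : s < a
  · have h0 : 0 < a := hs.trans_lt h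
    simp only [Set.indicator, Set.mem_Ioi, h0, h, sub_pos, if_true]
    rw [← mul_assoc, ← ENNReal.ofReal_mul (Real.exp_pos _).le, ← Real.exp_add]
    congr 3; ring
  · simp [Set.indicator, h]

/-- Renewal equation, by conditioning on the first ring: if it comes after time `s`, the lack of
memory makes the remaining waiting times fresh; if it comes at time `a ≤ s`, the observer arrives
at time `s - a` of the clock restarted at `a`. -/
lemma waitLaw_preimage_residual {A : Set (ℕ → ℝ)} (hA : MeasurableSet A) {s : ℝ} (hs : 0 ≤ s) :
    waitLaw (residual s ⁻¹' A) = ENNReal.ofReal (Real.exp (-s)) * waitLaw A +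
      ∫⁻ a in Set.Iic s, waitLaw (residual (s - a) ⁻¹' A) ∂(expMeasure 1) := by
  have hm : Measurable (residual s) := measurable_residual.comp measurable_prodMk_left
  have hprod : ∀ B : Set (ℕ → ℝ), MeasurableSet B → waitLaw B =
      ∫⁻ a, waitLaw (consSeq a ⁻¹' B) ∂(expMeasure 1) := fun B hB => by
    rw [← measurePreserving_consSeq.measure_preimage hB.nullMeasurableSet,
      Measure.prod_apply (measurable_consSeq hB)]
    rfl
  have hmeas : Measurable fun a => waitLaw (consSeq a ⁻¹' A) :=
    measurable_measure_prodMk_left (measurable_consSeq hA)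
  rw [hprod _ (hm hA), ← lintegral_add_compl _ (measurableSet_Ioi (a := s)), Set.compl_Ioi]
  congr 1
  · rw [hprod A hA, ← setLIntegral_Ioi_expMeasure_one hmeas hs]
    refine setLIntegral_congr_fun measurableSet_Ioi fun a ha => ?_
    congr 1
    ext u
    simp only [Set.mem_preimage, residual_consSeq_of_lt (Set.mem_Ioi.1 ha)]
  · refine setLIntegral_congr_fun measurableSet_Iic fun a ha => ?_
    congr 1
    ext u
    simp only [Set.mem_preimage, residual_consSeq_of_le (Set.mem_Iic.1 ha)]

lemma le_waitLaw_preimage_residual {A : Set (ℕ → ℝ)} (hA : MeasurableSet A) {K : ℝ} (hK : 0 ≤ K)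
    (n : ℕ) : ∀ s, 0 ≤ s → s ≤ K →
      ENNReal.ofReal (1 - (1 - Real.exp (-K)) ^ n) * waitLaw A ≤ waitLaw (residual s ⁻¹' A) := by
  have hq0 : 0 ≤ 1 - Real.exp (-K) := by simpa using hK
  have hq1 : 1 - Real.exp (-K) ≤ 1 := by linarith [Real.exp_pos (-K)]
  induction n with
  | zero => intro s _ _; simp
  | succ n ih =>
    intro s hs hsK
    set r := 1 - (1 - Real.exp (-K)) ^ n with hr
    have hr0 : 0 ≤ r := sub_nonneg.2 (pow_le_one₀ hq0 hq1)
    have hr1 : r ≤ 1 := by simpa [hr] using pow_nonneg hq0 n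
    rw [waitLaw_preimage_residual hA hs]
    have h1 : ENNReal.ofReal r * waitLaw A * ENNReal.ofReal (1 - Real.exp (-s)) ≤
        ∫⁻ a in Set.Iic s, waitLaw (residual (s - a) ⁻¹' A) ∂(expMeasure 1) := by
      rw [← expMeasure_one_Iic hs, ← setLIntegral_const]
      refine lintegral_mono_ae ?_
      filter_upwards [ae_restrict_of_ae ae_expMeasure_one_pos,
        ae_restrict_mem measurableSet_Iic] with a ha has
      exact ih _ (sub_nonneg.2 has) (by linarith)
    refine le_trans ?_ (add_le_add le_rfl h1)
    have hes : Real.exp (-K) ≤ Real.exp (-s) := Real.exp_le_exp.2 (by linarith)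
    have hes1 : 0 ≤ 1 - Real.exp (-s) := by simpa using hs
    rw [mul_right_comm, ← add_mul, ← ENNReal.ofReal_mul hr0,
      ← ENNReal.ofReal_add (Real.exp_pos _).le (mul_nonneg hr0 hes1)]
    gcongr
    have : 1 - (1 - Real.exp (-K)) ^ (n + 1) = r + Real.exp (-K) * (1 - r) := by
      rw [hr]; ring
    rw [this]
    nlinarith

/-- Whatever the time `s` at which an observer arrives, the waiting times still to come are again
independent and exponential of rate 1. If the law of the remaining waiting times is at least `r`
times `waitLaw` for all arrival times up to `K`, then conditioning on the first ring improves `r`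
to `r + exp (-K) * (1 - r)`; in the limit it is at least, hence equal to, `waitLaw`. -/
lemma measurePreserving_residual {s : ℝ} (hs : 0 ≤ s) :
    MeasurePreserving (residual s) waitLaw waitLaw := by
  have hm : Measurable (residual s) := measurable_residual.comp measurable_prodMk_left
  refine ⟨hm, ?_⟩
  have : IsProbabilityMeasure (waitLaw.map (residual s)) :=
    Measure.isProbabilityMeasure_map hm.aemeasurable
  refine (Measure.eq_of_le_of_isProbabilityMeasure (Measure.le_iff.2 fun A hA => ?_)).symm
  rw [Measure.map_apply hm hA]
  have hq0 : 0 ≤ 1 - Real.exp (-s) := by simpa using hs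
  have hq1 : 1 - Real.exp (-s) < 1 := by linarith [Real.exp_pos (-s)]
  have hlim : Filter.Tendsto
      (fun n : ℕ => ENNReal.ofReal (1 - (1 - Real.exp (-s)) ^ n) * waitLaw A)
      Filter.atTop (nhds (ENNReal.ofReal (1 - 0) * waitLaw A)) :=
    ENNReal.Tendsto.mul_const (ENNReal.tendsto_ofReal
      ((tendsto_pow_atTop_nhds_zero_of_lt_one hq0 hq1).const_sub 1)) (Or.inr (measure_ne_top _ _))
  rw [sub_zero, ENNReal.ofReal_one, one_mul] at hlim
  exact le_of_tendsto' hlim fun n => le_waitLaw_preimage_residual hA hs n s hs le_rfl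

lemma ae_waitLaw_pos : ∀ᵐ u ∂waitLaw, ∀ i, 0 < u i := by
  rw [ae_all_iff]
  intro i
  exact (measurePreserving_eval_infinitePi (fun _ : ℕ => expMeasure 1) i).quasiMeasurePreserving.ae
    ae_expMeasure_one_pos

lemma seqRing_mono {u : ℕ → ℝ} (hu : ∀ i, 0 ≤ u i) : Monotone (seqRing u) :=
  monotone_nat_of_le_succ fun k => by rw [seqRing_succ]; linarith [hu (k + 1)]

/-! ### Moments of exponential variables and of their maximum -/

/-- The exponential moment of order `3 / 4` of the exponential distribution. -/
lemma lintegral_exp_three_quarters :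
    ∫⁻ x, ENNReal.ofReal (Real.exp (3 / 4 * x)) ∂(expMeasure 1) = 4 := by
  rw [lintegral_expMeasure_one (by fun_prop)]
  have h : ∀ x : ℝ, ENNReal.ofReal (Real.exp (-x)) * ENNReal.ofReal (Real.exp (3 / 4 * x))
      = ENNReal.ofReal (Real.exp (-(1 / 4) * x)) := fun x => by
    rw [← ENNReal.ofReal_mul (Real.exp_pos _).le, ← Real.exp_add]
    congr 2; ring
  simp_rw [h]
  rw [← ofReal_integral_eq_lintegral_ofReal (integrableOn_exp_mul_Ioi (by norm_num) 0)
    (Filter.Eventually.of_forall fun x => (Real.exp_pos _).le),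
    integral_exp_mul_Ioi (by norm_num)]
  norm_num

/-- The exponential moment of order `-1` of the exponential distribution. -/
lemma lintegral_exp_neg :
    ∫⁻ x, ENNReal.ofReal (Real.exp (-x)) ∂(expMeasure 1) = 2⁻¹ := by
  rw [lintegral_expMeasure_one (by fun_prop)]
  have h : ∀ x : ℝ, ENNReal.ofReal (Real.exp (-x)) * ENNReal.ofReal (Real.exp (-x))
      = ENNReal.ofReal (Real.exp (-2 * x)) := fun x => by
    rw [← ENNReal.ofReal_mul (Real.exp_pos _).le, ← Real.exp_add]
    congr 2; ring
  simp_rw [h]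
  rw [← ofReal_integral_eq_lintegral_ofReal (integrableOn_exp_mul_Ioi (by norm_num) 0)
    (Filter.Eventually.of_forall fun x => (Real.exp_pos _).le),
    integral_exp_mul_Ioi (by norm_num)]
  rw [mul_zero, Real.exp_zero, neg_div_neg_eq, one_div, ENNReal.ofReal_inv_of_pos (by norm_num)]
  simp

lemma lintegral_one_sub_exp_neg_pow (i : ℕ) :
    ∫⁻ t in Set.Ioi (0 : ℝ), ENNReal.ofReal ((1 - Real.exp (-t)) ^ i * Real.exp (-t))
      = ENNReal.ofReal ((i + 1 : ℝ)⁻¹) := by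
  have hd : ∀ t ∈ Set.Ici (0 : ℝ), HasDerivAt (fun t : ℝ => (1 - Real.exp (-t)) ^ (i + 1) / (i + 1))
      ((1 - Real.exp (-t)) ^ i * Real.exp (-t)) t := fun t _ => by
    have h1 : HasDerivAt (fun t : ℝ => 1 - Real.exp (-t)) (Real.exp (-t)) t := by
      simpa using ((hasDerivAt_neg t).exp).const_sub 1
    have h2 := (h1.pow (i + 1)).div_const ((i : ℝ) + 1)
    convert! h2 using 1
    push_cast
    field_simp
  have hlim : Filter.Tendsto (fun t : ℝ => (1 - Real.exp (-t)) ^ (i + 1) / (i + 1)) Filter.atTop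
      (nhds ((1 - 0) ^ (i + 1) / (i + 1))) :=
    (((Real.tendsto_exp_neg_atTop_nhds_zero).const_sub 1).pow (i + 1)).div_const _
  have hpos : ∀ t ∈ Set.Ioi (0 : ℝ), 0 ≤ (1 - Real.exp (-t)) ^ i * Real.exp (-t) := fun t ht =>
    mul_nonneg (pow_nonneg (by simpa using (Set.mem_Ioi.1 ht).le) _) (Real.exp_pos _).le
  rw [← ofReal_integral_eq_lintegral_ofReal
      (integrableOn_Ioi_deriv_of_nonneg' hd hpos hlim)
      ((ae_restrict_iff' measurableSet_Ioi).2 (Filter.Eventually.of_forall hpos)),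
    integral_Ioi_of_hasDerivAt_of_nonneg' hd hpos hlim]
  congr 1
  simp

/-! ### Phases: waiting until every clock has rung -/

section Phases

variable {V : Type*} [Fintype V]

/-- The law of the waiting times of all clocks, arranged as one sequence for each vertex. -/
noncomputable def clocksLaw (V : Type*) [Fintype V] : Measure (V → ℕ → ℝ) :=
  Measure.pi fun _ => waitLaw

instance : IsProbabilityMeasure (clocksLaw V) := by unfold clocksLaw; infer_instance

instance : IsProbabilityMeasure (clockLaw V) := by unfold clockLaw; infer_instance

lemma measurePreserving_curry :
    MeasurePreserving (fun (w : V × ℕ → ℝ) x k => w (x, k)) (clockLaw V) (clocksLaw V) := by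
  refine ⟨by fun_prop, ?_⟩
  exact (Measure.infinitePi_map_curry (fun (_ : V) (_ : ℕ) => expMeasure 1)).trans
    (Measure.infinitePi_eq_pi _)

lemma ae_clocksLaw_pos : ∀ᵐ W ∂(clocksLaw V), ∀ x i, 0 < W x i := by
  rw [ae_all_iff]
  intro x
  exact (measurePreserving_eval (fun _ : V => waitLaw) x).quasiMeasurePreserving.ae ae_waitLaw_pos

variable [Nonempty V]

/-- The largest entry of a family of real numbers. -/
noncomputable def maxEntry (a : V → ℝ) : ℝ := Finset.univ.sup' Finset.univ_nonempty a

lemma le_maxEntry (a : V → ℝ) (x : V) : a x ≤ maxEntry a :=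
  Finset.le_sup' a (Finset.mem_univ x)

lemma measurable_maxEntry : Measurable (maxEntry : (V → ℝ) → ℝ) := by
  have h : (maxEntry : (V → ℝ) → ℝ)
      = Finset.univ.sup' Finset.univ_nonempty (fun (x : V) (a : V → ℝ) => a x) := by
    funext a; rw [Finset.sup'_apply]; rfl
  rw [h]
  exact Finset.measurable_sup' _ fun x _ => measurable_pi_apply x

variable (V) in
/-- The law of the maximum of independent exponential variables of rate 1 indexed by `V`. -/
noncomputable def maxLaw : Measure ℝ := (Measure.pi fun _ : V => expMeasure 1).map maxEntry

instance : IsProbabilityMeasure (maxLaw V) :=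
  Measure.isProbabilityMeasure_map measurable_maxEntry.aemeasurable

/-- The time it takes until all clocks have rung. -/
noncomputable def phaseLength (W : V → ℕ → ℝ) : ℝ := maxEntry fun x => W x 0

/-- The waiting times of the clocks, as seen at the end of the first phase. -/
noncomputable def nextClocks (W : V → ℕ → ℝ) : V → ℕ → ℝ :=
  fun x => residual (phaseLength W) (W x)

lemma measurable_phaseLength : Measurable (phaseLength : (V → ℕ → ℝ) → ℝ) :=
  measurable_maxEntry.comp (by fun_prop)

lemma measurable_nextClocks : Measurable (nextClocks : (V → ℕ → ℝ) → V → ℕ → ℝ) :=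
  measurable_pi_lambda _ fun x =>
    measurable_residual.comp (measurable_phaseLength.prodMk (measurable_pi_apply x))

/-- Strong Markov property at the end of the first phase: given the first waiting times, the
remaining ones are observed from deterministic times on, so that `measurePreserving_residual`
applies to each clock. -/
lemma measurePreserving_phase :
    MeasurePreserving (fun W : V → ℕ → ℝ => (phaseLength W, nextClocks W))
      (clocksLaw V) ((maxLaw V).prod (clocksLaw V)) := by
  have hE : MeasurePreserving
      (fun (p : (V → ℝ) × (V → ℕ → ℝ)) (x : V) => consSeq (p.1 x) (p.2 x))
      ((Measure.pi fun _ : V => expMeasure 1).prod (clocksLaw V)) (clocksLaw V) :=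
    (measurePreserving_pi (fun _ : V => (expMeasure 1).prod waitLaw) (fun _ : V => waitLaw)
      (fun _ => measurePreserving_consSeq)).comp
      (measurePreserving_arrowProdEquivProdArrow ℝ (ℕ → ℝ) V (fun _ => expMeasure 1)
        (fun _ => waitLaw)).symm
  have hF : MeasurePreserving (fun p : (V → ℝ) × (V → ℕ → ℝ) =>
      (maxEntry p.1, fun x => residual (maxEntry p.1 - p.1 x) (p.2 x)))
      ((Measure.pi fun _ : V => expMeasure 1).prod (clocksLaw V))
      ((maxLaw V).prod (clocksLaw V)) := by
    refine MeasurePreserving.skew_product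
      (g := fun (a : V → ℝ) (W : V → ℕ → ℝ) x => residual (maxEntry a - a x) (W x))
      ⟨measurable_maxEntry, rfl⟩ ?_ (Filter.Eventually.of_forall fun a => ?_)
    · refine measurable_pi_lambda _ fun x => measurable_residual.comp (Measurable.prodMk ?_ ?_)
      · exact (measurable_maxEntry.comp measurable_fst).sub
          ((measurable_pi_apply x).comp measurable_fst)
      · exact (measurable_pi_apply x).comp measurable_snd
    · exact (measurePreserving_pi (fun _ : V => waitLaw) (fun _ : V => waitLaw)
        fun x => measurePreserving_residual (sub_nonneg.2 (le_maxEntry a x))).map_eq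
  have hG : Measurable fun W : V → ℕ → ℝ => (phaseLength W, nextClocks W) :=
    measurable_phaseLength.prodMk measurable_nextClocks
  refine ⟨hG, ?_⟩
  conv_lhs => rw [← hE.map_eq]
  rw [Measure.map_map hG hE.measurable, ← hF.map_eq]
  congr 1
  funext p
  refine Prod.ext rfl (funext fun x => ?_)
  exact residual_consSeq_of_le (le_maxEntry p.1 x) (p.2 x)

lemma measurePreserving_nextClocks :
    MeasurePreserving (nextClocks : (V → ℕ → ℝ) → V → ℕ → ℝ) (clocksLaw V) (clocksLaw V) :=
  measurePreserving_snd.comp measurePreserving_phase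

lemma measurePreserving_phaseLength :
    MeasurePreserving (phaseLength : (V → ℕ → ℝ) → ℝ) (clocksLaw V) (maxLaw V) :=
  measurePreserving_fst.comp measurePreserving_phase

lemma ae_maxLaw_pos : ∀ᵐ m ∂(maxLaw V), 0 < m := by
  rw [← measurePreserving_phaseLength.map_eq,
    ae_map_iff measurable_phaseLength.aemeasurable measurableSet_Ioi]
  filter_upwards [ae_clocksLaw_pos] with W hW
  exact (hW (Classical.arbitrary V) 0).trans_le (le_maxEntry (fun x => W x 0) _)

lemma maxLaw_Ioi {t : ℝ} (ht : 0 ≤ t) :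
    maxLaw V (Set.Ioi t) = ENNReal.ofReal (1 - (1 - Real.exp (-t)) ^ Fintype.card V) := by
  have h0 : 0 ≤ 1 - Real.exp (-t) := by simpa using ht
  have h1 : maxLaw V (Set.Iic t) = ENNReal.ofReal ((1 - Real.exp (-t)) ^ Fintype.card V) := by
    rw [maxLaw, Measure.map_apply measurable_maxEntry measurableSet_Iic]
    have : (maxEntry : (V → ℝ) → ℝ) ⁻¹' Set.Iic t = Set.univ.pi fun _ => Set.Iic t := by
      ext a
      simp [maxEntry, Finset.sup'_le_iff, Pi.le_def]
    rw [this, Measure.pi_pi, Finset.prod_const, expMeasure_one_Iic ht, ENNReal.ofReal_pow h0]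
    rfl
  rw [← Set.compl_Iic, prob_compl_eq_one_sub measurableSet_Iic, h1, ← ENNReal.ofReal_one,
    ← ENNReal.ofReal_sub _ (pow_nonneg h0 _)]

/-- The maximum of `n` independent exponential variables has mean `H n`: its tail is
`1 - (1 - exp (-t)) ^ n = ∑ i < n, (1 - exp (-t)) ^ i * exp (-t)`, whose terms integrate to
`1 / (i + 1)`. -/
lemma lintegral_maxLaw : ∫⁻ m, ENNReal.ofReal m ∂(maxLaw V) = H (Fintype.card V) := by
  rw [lintegral_eq_lintegral_meas_lt (maxLaw V) (ae_maxLaw_pos.mono fun m hm => hm.le)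
    aemeasurable_id']
  have h : ∀ t ∈ Set.Ioi (0 : ℝ), maxLaw V {a | t < a} = ∑ i ∈ Finset.range (Fintype.card V),
      ENNReal.ofReal ((1 - Real.exp (-t)) ^ i * Real.exp (-t)) := fun t ht => by
    have h0 : 0 ≤ 1 - Real.exp (-t) := by simpa using (Set.mem_Ioi.1 ht).le
    rw [← ENNReal.ofReal_sum_of_nonneg
      (fun i _ => mul_nonneg (pow_nonneg h0 _) (Real.exp_pos _).le), ← Finset.sum_mul]
    refine (maxLaw_Ioi (Set.mem_Ioi.1 ht).le).trans ?_
    rw [← geom_sum_mul_neg, sub_sub_cancel]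
  rw [setLIntegral_congr_fun measurableSet_Ioi h, lintegral_finsetSum _ (fun i _ => by fun_prop)]
  simp_rw [lintegral_one_sub_exp_neg_pow]
  rw [← ENNReal.ofReal_sum_of_nonneg (fun i _ => by positivity), H, harmonic]
  push_cast
  rfl

/-- Bounding the maximum by the sum gives an exponential moment linear in the number of vertices. -/
lemma lintegral_exp_maxLaw_le :
    ∫⁻ m, ENNReal.ofReal (Real.exp (3 / 4 * m)) ∂(maxLaw V) ≤ 4 * Fintype.card V := by
  rw [maxLaw, lintegral_map (by fun_prop) measurable_maxEntry]
  calc ∫⁻ a, ENNReal.ofReal (Real.exp (3 / 4 * maxEntry a)) ∂(Measure.pi fun _ : V => expMeasure 1)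
      ≤ ∫⁻ a, ∑ x : V, ENNReal.ofReal (Real.exp (3 / 4 * a x))
          ∂(Measure.pi fun _ : V => expMeasure 1) := by
        refine lintegral_mono fun a => ?_
        obtain ⟨x, -, hx⟩ := Finset.exists_mem_eq_sup' Finset.univ_nonempty a
        rw [maxEntry, hx]
        exact Finset.single_le_sum (f := fun x => ENNReal.ofReal (Real.exp (3 / 4 * a x)))
          (fun _ _ => zero_le) (Finset.mem_univ x)
    _ = ∑ _x : V, 4 := by
        rw [lintegral_finsetSum _ (fun i _ => by fun_prop)]
        refine Finset.sum_congr rfl fun x _ => ?_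
        rw [← lintegral_exp_three_quarters,
          ← (measurePreserving_eval (fun _ : V => expMeasure 1) x).lintegral_comp
            (f := fun t => ENNReal.ofReal (Real.exp (3 / 4 * t))) (by fun_prop)]
    _ = 4 * Fintype.card V := by simp [mul_comm]

/-- The end of phase number `k`; a phase lasts until every clock has rung since its start. -/
noncomputable def phaseEnd (k : ℕ) (W : V → ℕ → ℝ) : ℝ :=
  ∑ j ∈ Finset.range k, phaseLength (nextClocks^[j] W)

/-- The number of rings of the clock of `x` during the first `k` phases. -/
noncomputable def phaseCount (k : ℕ) (W : V → ℕ → ℝ) (x : V) : ℕ :=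
  ∑ j ∈ Finset.range k, ringCount (phaseLength (nextClocks^[j] W)) (nextClocks^[j] W x)

lemma phaseEnd_succ' (k : ℕ) (W : V → ℕ → ℝ) :
    phaseEnd (k + 1) W = phaseLength W + phaseEnd k (nextClocks W) := by
  rw [phaseEnd, Finset.sum_range_succ', add_comm]; rfl

lemma phaseEnd_succ (k : ℕ) (W : V → ℕ → ℝ) :
    phaseEnd (k + 1) W = phaseEnd k W + phaseLength (nextClocks^[k] W) :=
  Finset.sum_range_succ _ _

lemma phaseCount_succ (k : ℕ) (W : V → ℕ → ℝ) (x : V) : phaseCount (k + 1) W x =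
    phaseCount k W x + ringCount (phaseLength (nextClocks^[k] W)) (nextClocks^[k] W x) :=
  Finset.sum_range_succ _ _

lemma measurable_phaseEnd (k : ℕ) : Measurable (phaseEnd k : (V → ℕ → ℝ) → ℝ) :=
  Finset.measurable_sum _ fun j _ => measurable_phaseLength.comp (measurable_nextClocks.iterate j)

lemma measurable_phaseCount (k : ℕ) (x : V) :
    Measurable fun W : V → ℕ → ℝ => phaseCount k W x :=
  Finset.measurable_sum _ fun j _ => measurable_ringCount.comp
    ((measurable_phaseLength.comp (measurable_nextClocks.iterate j)).prodMk
      ((measurable_pi_apply x).comp (measurable_nextClocks.iterate j)))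

lemma lintegral_phaseEnd_le (k : ℕ) :
    ∫⁻ W, ENNReal.ofReal (phaseEnd k W) ∂(clocksLaw V) ≤ H (Fintype.card V) * k := by
  calc ∫⁻ W, ENNReal.ofReal (phaseEnd k W) ∂(clocksLaw V)
      ≤ ∫⁻ W : V → ℕ → ℝ, ∑ j ∈ Finset.range k,
          ENNReal.ofReal (phaseLength (nextClocks^[j] W)) ∂(clocksLaw V) :=
        lintegral_mono fun W => Finset.le_sum_of_subadditive _ ENNReal.ofReal_zero.le
          (fun _ _ => ENNReal.ofReal_add_le) _ _
    _ = ∑ j ∈ Finset.range k, H (Fintype.card V) := by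
        have hm : ∀ j, Measurable fun W : V → ℕ → ℝ =>
            ENNReal.ofReal (phaseLength (nextClocks^[j] W)) := fun j =>
          (measurable_phaseLength.comp (measurable_nextClocks.iterate j)).ennreal_ofReal
        rw [lintegral_finsetSum _ fun j _ => hm j]
        refine Finset.sum_congr rfl fun j _ => ?_
        rw [← lintegral_maxLaw]
        exact (measurePreserving_phaseLength.comp
          (measurePreserving_nextClocks.iterate j)).lintegral_comp ENNReal.measurable_ofReal
    _ = H (Fintype.card V) * k := by simp [mul_comm]

lemma lintegral_exp_phaseEnd_le (k : ℕ) :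
    ∫⁻ W, ENNReal.ofReal (Real.exp (3 / 4 * phaseEnd k W)) ∂(clocksLaw V)
      ≤ (4 * Fintype.card V) ^ k := by
  induction k with
  | zero => simp [phaseEnd]
  | succ k ih =>
    have hf : Measurable fun m : ℝ => ENNReal.ofReal (Real.exp (3 / 4 * m)) := by fun_prop
    have hg : Measurable fun W : V → ℕ → ℝ => ENNReal.ofReal (Real.exp (3 / 4 * phaseEnd k W)) :=
      hf.comp (measurable_phaseEnd k)
    calc ∫⁻ W, ENNReal.ofReal (Real.exp (3 / 4 * phaseEnd (k + 1) W)) ∂(clocksLaw V)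
        = ∫⁻ W : V → ℕ → ℝ, (fun p : ℝ × (V → ℕ → ℝ) => ENNReal.ofReal (Real.exp (3 / 4 * p.1)) *
            ENNReal.ofReal (Real.exp (3 / 4 * phaseEnd k p.2))) (phaseLength W, nextClocks W)
            ∂(clocksLaw V) := by
          refine lintegral_congr fun W => ?_
          rw [phaseEnd_succ', mul_add, Real.exp_add, ENNReal.ofReal_mul (Real.exp_pos _).le]
      _ = (∫⁻ m, ENNReal.ofReal (Real.exp (3 / 4 * m)) ∂(maxLaw V)) *
            ∫⁻ W, ENNReal.ofReal (Real.exp (3 / 4 * phaseEnd k W)) ∂(clocksLaw V) := by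
          rw [← lintegral_prod_mul hf.aemeasurable hg.aemeasurable]
          exact measurePreserving_phase.lintegral_comp
            ((hf.comp measurable_fst).mul (hg.comp measurable_snd))
      _ ≤ 4 * Fintype.card V * (4 * Fintype.card V) ^ k :=
          mul_le_mul' lintegral_exp_maxLaw_le ih
      _ = (4 * Fintype.card V) ^ (k + 1) := (pow_succ' _ _).symm

/-- Almost surely, at the start of every phase all waiting times still to come are positive. -/
lemma ae_iterate_nextClocks_pos :
    ∀ᵐ W ∂(clocksLaw V), ∀ j x i, 0 < (nextClocks^[j] W) x i := by
  rw [ae_all_iff]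
  intro j
  exact (measurePreserving_nextClocks.iterate j).quasiMeasurePreserving.ae ae_clocksLaw_pos

/-- If some clock stopped ringing during a phase, then `residual` would be the constant sequence
`0` from the next phase on, against the positivity of the waiting times. -/
lemma exists_ring_after_phase {W : V → ℕ → ℝ} (hW : ∀ j x i, 0 < (nextClocks^[j] W) x i) (j : ℕ)
    (x : V) : ∃ m, phaseLength (nextClocks^[j] W) < seqRing (nextClocks^[j] W x) m := by
  by_contra h
  have h1 := hW (j + 1) x 0
  rw [Function.iterate_succ_apply', nextClocks, residual_of_not_exists h] at h1
  exact lt_irrefl _ h1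

/-- After `k` phases the clock of `x` goes on as before, with its first `phaseCount k W x` rings
removed and time measured from `phaseEnd k W` on. -/
lemma seqRing_iterate_nextClocks {W : V → ℕ → ℝ} (hW : ∀ j x i, 0 < (nextClocks^[j] W) x i)
    (k : ℕ) (x : V) (i : ℕ) :
    seqRing (nextClocks^[k] W x) i = seqRing (W x) (phaseCount k W x + i) - phaseEnd k W := by
  induction k generalizing i with
  | zero => simp [phaseCount, phaseEnd]
  | succ k ih =>
    rw [Function.iterate_succ_apply', nextClocks, seqRing_residual (exists_ring_after_phase hW k x),
      ih, phaseCount_succ, phaseEnd_succ, add_assoc]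
    ring

/-- Every clock rings in every phase. -/
lemma phaseCount_strictMono {W : V → ℕ → ℝ} (hW : ∀ j x i, 0 < (nextClocks^[j] W) x i) (x : V) :
    StrictMono fun k => phaseCount k W x := by
  refine strictMono_nat_of_lt_succ fun k => ?_
  rw [phaseCount_succ, Nat.lt_add_right_iff_pos]
  by_contra h
  have h1 := ringCount_spec (exists_ring_after_phase hW k x)
  rw [Nat.eq_zero_of_not_pos h, seqRing_zero] at h1
  exact absurd h1 (not_lt.2 (le_maxEntry (fun x => (nextClocks^[k] W) x 0) x))

end Phases

/-! ### The synchronous protocol -/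

section Sync

variable {V : Type*}

lemma syncInformed_mono (c : V × ℕ → V) (v : V) : Monotone (syncInformed c v) :=
  monotone_nat_of_le_succ fun _ _ hu => Or.inl hu

lemma source_mem_syncInformed (c : V × ℕ → V) (v : V) (k : ℕ) : v ∈ syncInformed c v k :=
  syncInformed_mono c v (Nat.zero_le k) rfl

lemma syncSpreadTime_le {c : V × ℕ → V} {v : V} {k : ℕ} (h : ∀ u, u ∈ syncInformed c v k) :
    syncSpreadTime v c ≤ k := iInf₂_le k h

lemma le_syncSpreadTime {c : V × ℕ → V} {v : V} {k : ℕ} (h : ¬ ∀ u, u ∈ syncInformed c v k) :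
    (k : ℝ≥0∞) + 1 ≤ syncSpreadTime v c := by
  refine le_iInf₂ fun j hj => ?_
  have : k < j := by
    by_contra hjk
    exact h fun u => syncInformed_mono c v (not_lt.1 hjk) (hj u)
  exact_mod_cast this

/-- Whoever is informed by a fresh start from `v` after round `k` is informed by the running
process. -/
lemma syncInformed_shift_subset (c : V × ℕ → V) (v : V) (k j : ℕ) :
    syncInformed (fun p => c (p.1, k + p.2)) v j ⊆ syncInformed c v (k + j) := by
  induction j with
  | zero => intro u hu; rw [show u = v from hu]; exact source_mem_syncInformed c v k
  | succ j ih =>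
    rintro u (h | ⟨x, hx, rfl⟩ | h)
    · exact Or.inl (ih h)
    · exact Or.inr (Or.inl ⟨x, ih hx, rfl⟩)
    · exact Or.inr (Or.inr (ih h))

lemma syncInformed_congr {c c' : V × ℕ → V} (v : V) {k : ℕ}
    (h : ∀ x, ∀ i < k, c (x, i) = c' (x, i)) : syncInformed c v k = syncInformed c' v k := by
  induction k with
  | zero => rfl
  | succ k ih =>
    have h1 := ih fun x i hi => h x i (hi.trans (Nat.lt_succ_self k))
    ext u
    simp only [syncInformed, Set.mem_ofPred_eq, h1, h _ k (Nat.lt_succ_self k)]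

variable [Fintype V] [MeasurableSpace V]

instance (G : SimpleGraph V) : IsProbabilityMeasure (callListLaw G) := by
  unfold callListLaw; infer_instance

instance (G : SimpleGraph V) : IsProbabilityMeasure (asyncLaw G) := by
  unfold asyncLaw; infer_instance

variable [DiscreteMeasurableSpace V]

lemma measurableSet_mem_syncInformed (v u : V) (k : ℕ) :
    MeasurableSet {c : V × ℕ → V | u ∈ syncInformed c v k} := by
  have hc : ∀ p y, MeasurableSet {c : V × ℕ → V | c p = y} := fun p y =>
    measurableSet_eq_fun (measurable_pi_apply p) measurable_const
  induction k generalizing u with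
  | zero => exact MeasurableSet.const _
  | succ k ih =>
    have h : {c : V × ℕ → V | u ∈ syncInformed c v (k + 1)} =
        {c | u ∈ syncInformed c v k} ∪
        ((⋃ x, {c | x ∈ syncInformed c v k} ∩ {c | c (x, k) = u}) ∪
        ⋃ y, {c | y ∈ syncInformed c v k} ∩ {c | c (u, k) = y}) := by
      ext c
      simp [syncInformed]
    rw [h]
    exact (ih u).union ((MeasurableSet.iUnion fun x => (ih x).inter (hc _ _)).union
      (MeasurableSet.iUnion fun y => (ih y).inter (hc _ _)))

lemma measurableSet_syncInformed_all (v : V) (k : ℕ) :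
    MeasurableSet {c : V × ℕ → V | ∀ u, u ∈ syncInformed c v k} := by
  rw [Set.ofPred_forall]
  exact .iInter fun u => measurableSet_mem_syncInformed v u k

/-- If the rumour fails to spread in `2 * k` rounds, then it fails to spread both in the first `k`
rounds and, started afresh from `v`, in the next `k` rounds; these events are independent. -/
lemma callListLaw_not_all_two_mul_le (G : SimpleGraph V) (v : V) (k : ℕ) :
    callListLaw G {c | ¬ ∀ u, u ∈ syncInformed c v (k + k)} ≤
      callListLaw G {c | ¬ ∀ u, u ∈ syncInformed c v k} ^ 2 := by
  classical
  set A : Set (V × ℕ → V) := {c | ¬ ∀ u, u ∈ syncInformed c v k} with hA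
  let shift : (V × ℕ → V) → V × ℕ → V := fun c p => c (p.1, k + p.2)
  have hAm : MeasurableSet A := (measurableSet_syncInformed_all v k).compl
  have hinj : Function.Injective fun p : V × ℕ => (p.1, k + p.2) := by
    rintro ⟨x, i⟩ ⟨y, j⟩ h
    simpa using h
  have hshift : callListLaw G (shift ⁻¹' A) = callListLaw G A := by
    have h := Measure.map_infinitePi_infinitePi_of_inj
      (P := fun p : V × ℕ => (callLaw G p.1).toMeasure) hinj
    rw [callListLaw]
    nth_rewrite 2 [← h]
    rw [Measure.map_apply (by fun_prop) hAm]
  -- the two events depend on the disjoint finite sets `S` and `T` of calls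
  let S : Finset (V × ℕ) := Finset.univ ×ˢ Finset.range k
  let T : Finset (V × ℕ) := Finset.univ ×ˢ Finset.Ico k (k + k)
  have hST : Disjoint S T := by
    rw [Finset.disjoint_left]
    rintro ⟨x, i⟩ h1 h2
    simp only [S, T, Finset.mem_product, Finset.mem_range, Finset.mem_Ico] at h1 h2
    omega
  have hind := (iIndepFun_infinitePi (P := fun p : V × ℕ => (callLaw G p.1).toMeasure)
    (X := fun _ y => y) (fun _ => measurable_id)).indepFun_finset S T hST
    (fun p => measurable_pi_apply p)
  let A₁ : Set (S → V) := {r | ¬ ∀ u, u ∈ syncInformed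
    (fun p => if h : p ∈ S then r ⟨p, h⟩ else v) v k}
  let A₂ : Set (T → V) := {r | ¬ ∀ u, u ∈ syncInformed
    (fun p => if h : (p.1, k + p.2) ∈ T then r ⟨(p.1, k + p.2), h⟩ else v) v k}
  have h1 : A = (fun (c : V × ℕ → V) (p : S) => c p) ⁻¹' A₁ := by
    ext c
    simp only [hA, A₁, Set.mem_preimage, Set.mem_ofPred_eq]
    rw [syncInformed_congr (c := c) v fun x i hi => ?_]
    simp [S, hi]
  have h2 : shift ⁻¹' A = (fun (c : V × ℕ → V) (p : T) => c p) ⁻¹' A₂ := by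
    ext c
    simp only [hA, A₂, Set.mem_preimage, Set.mem_ofPred_eq]
    rw [syncInformed_congr (c := shift c) v fun x i hi => ?_]
    simp [T, hi, shift]
  calc callListLaw G {c | ¬ ∀ u, u ∈ syncInformed c v (k + k)}
      ≤ callListLaw G (A ∩ shift ⁻¹' A) := by
        refine measure_mono fun c hc => ⟨fun h => hc fun u => ?_, fun h => hc fun u => ?_⟩
        · exact syncInformed_mono c v (Nat.le_add_right k k) (h u)
        · exact syncInformed_shift_subset c v k k (h u)
    _ = callListLaw G A * callListLaw G (shift ⁻¹' A) := by
        rw [h2, h1]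
        exact hind.measure_inter_preimage_eq_mul _ _ (Set.toFinite _).measurableSet
          (Set.toFinite _).measurableSet
    _ = callListLaw G A ^ 2 := by rw [hshift, sq]

/-- Almost surely, every call goes to a neighbour. -/
lemma ae_callListLaw_adj {G : SimpleGraph V} (hG : ∀ x, ∃ y, G.Adj x y) :
    ∀ᵐ c ∂(callListLaw G), ∀ p : V × ℕ, G.Adj p.1 (c p) := by
  classical
  rw [ae_all_iff]
  intro p
  refine (measurePreserving_eval_infinitePi
    (fun p : V × ℕ => (callLaw G p.1).toMeasure) p).quasiMeasurePreserving.ae ?_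
  rw [ae_iff, PMF.toMeasure_apply_eq_zero_iff _ (MeasurableSet.of_discrete)]
  obtain ⟨y, hy⟩ := hG p.1
  rw [callLaw, dif_pos ⟨y, by simpa using hy⟩, Set.disjoint_left]
  intro z hz
  simpa using (PMF.mem_support_uniformOfFinset_iff _ _).1 hz

end Sync

/-! ### The coupling -/

section Coupling

variable {V : Type*}

lemma AsyncKnows.mono {w : V × ℕ → ℝ} {c : V × ℕ → V} {v u : V} {s t : ℝ}
    (h : AsyncKnows w c v u s) (hst : s ≤ t) : AsyncKnows w c v u t := by
  cases h with
  | source h => exact .source (h.trans hst)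
  | push h h1 h2 => exact .push h h1 (h2.trans hst)
  | pull h h1 h2 => exact .pull h h1 (h2.trans hst)

variable [Fintype V] [Nonempty V]

/-- The calling lists consisting of the first call of every vertex in every phase. -/
noncomputable def phaseCalls (W : V → ℕ → ℝ) (c : V × ℕ → V) : V × ℕ → V :=
  fun p => c (p.1, phaseCount p.2 W p.1)

/-- The first call of every vertex in phase `k` plays the role of its call in round `k`: whoever
is informed after `k` synchronous rounds is informed asynchronously at the end of phase `k`. -/
lemma asyncKnows_phaseEnd {w : V × ℕ → ℝ} {c : V × ℕ → V} {W : V → ℕ → ℝ}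
    (hw : ∀ x i, W x i = w (x, i)) (hW : ∀ j x i, 0 < (nextClocks^[j] W) x i) {v : V} (k : ℕ) :
    ∀ u ∈ syncInformed (phaseCalls W c) v k, AsyncKnows w c v u (phaseEnd k W) := by
  induction k with
  | zero => rintro _ rfl; exact .source (by simp [phaseEnd])
  | succ k ih =>
    have hring : ∀ x, ringTime w x (phaseCount k W x) = phaseEnd k W + (nextClocks^[k] W) x 0 :=
      fun x => by
        have h := seqRing_iterate_nextClocks hW k x 0
        rw [seqRing_zero, add_zero] at h
        rw [h, add_sub_cancel]
        simp only [ringTime, seqRing, hw]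
    have hlt : ∀ x, phaseEnd k W < ringTime w x (phaseCount k W x) := fun x => by
      rw [hring]; linarith [hW k x 0]
    have hle : ∀ x, ringTime w x (phaseCount k W x) ≤ phaseEnd (k + 1) W := fun x => by
      rw [hring, phaseEnd_succ]
      exact add_le_add le_rfl (le_maxEntry (fun x => (nextClocks^[k] W) x 0) x)
    rintro u (h | ⟨x, hx, rfl⟩ | h)
    · exact (ih u h).mono ((hlt u).le.trans (hle u))
    · exact .push (ih x hx) (hlt x) (hle x)
    · exact .pull (ih _ h) (hlt u) (hle u)

lemma asyncSpreadTime_le_phaseEnd {w : V × ℕ → ℝ} {c : V × ℕ → V} {W : V → ℕ → ℝ}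
    (hw : ∀ x i, W x i = w (x, i)) (hW : ∀ j x i, 0 < (nextClocks^[j] W) x i) {v : V} {k : ℕ}
    (h : ∀ u, u ∈ syncInformed (phaseCalls W c) v k) :
    asyncSpreadTime v (w, c) ≤ ENNReal.ofReal (phaseEnd k W) :=
  iInf₂_le (phaseEnd k W).toNNReal fun u =>
    (asyncKnows_phaseEnd hw hW k u (h u)).mono (Real.le_coe_toNNReal _)

variable [MeasurableSpace V]

lemma measurable_phaseCalls :
    Measurable fun p : (V → ℕ → ℝ) × (V × ℕ → V) => phaseCalls p.1 p.2 := by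
  refine measurable_pi_lambda _ fun q => ?_
  have h : Measurable fun p : (V × ℕ → V) × ℕ => p.1 (q.1, p.2) :=
    measurable_from_prod_countable_left fun i => measurable_pi_apply (q.1, i)
  exact h.comp (measurable_snd.prodMk ((measurable_phaseCount q.2 q.1).comp measurable_fst))

lemma ae_asyncLaw_iterate_nextClocks_pos (G : SimpleGraph V) :
    ∀ᵐ ω ∂(asyncLaw G), ∀ j x i, 0 < (nextClocks^[j] (fun x k => ω.1 (x, k) : V → ℕ → ℝ)) x i :=
  (measurePreserving_curry.comp (measurePreserving_fst (μ := clockLaw V)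
    (ν := callListLaw G))).quasiMeasurePreserving.ae ae_iterate_nextClocks_pos

/-- The first calls of the phases are again calling lists of independent uniform neighbours,
independent of the clocks: for given clocks they are obtained by an injective reindexing. -/
lemma measurePreserving_phaseCalls (G : SimpleGraph V) :
    MeasurePreserving (fun ω : (V × ℕ → ℝ) × (V × ℕ → V) =>
      ((fun x k => ω.1 (x, k) : V → ℕ → ℝ), phaseCalls (fun x k => ω.1 (x, k)) ω.2))
      (asyncLaw G) ((clocksLaw V).prod (callListLaw G)) := by
  refine MeasurePreserving.skew_product (μa := clockLaw V)
    (f := fun (w : V × ℕ → ℝ) x k => w (x, k))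
    (g := fun (w : V × ℕ → ℝ) c => phaseCalls (fun x k => w (x, k)) c)
    measurePreserving_curry ?_ ?_
  · exact measurable_phaseCalls.comp
      ((measurePreserving_curry.measurable.comp measurable_fst).prodMk measurable_snd)
  · filter_upwards [measurePreserving_curry.quasiMeasurePreserving.ae
      (ae_iterate_nextClocks_pos (V := V))] with w hw
    refine Measure.map_infinitePi_infinitePi_of_inj
      (P := fun p : V × ℕ => (callLaw G p.1).toMeasure)
      (f := fun p : V × ℕ => (p.1, phaseCount p.2 (fun x k => w (x, k)) p.1)) ?_
    rintro ⟨x, i⟩ ⟨y, j⟩ h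
    obtain ⟨rfl, h⟩ := Prod.mk.injEq .. ▸ h
    exact Prod.ext rfl ((phaseCount_strictMono hw x).injective h)

variable [DiscreteMeasurableSpace V]

lemma lintegral_asyncSpreadTime_le (G : SimpleGraph V) (v : V) :
    ∫⁻ ω, asyncSpreadTime v ω ∂(asyncLaw G) ≤
      H (Fintype.card V) * ∫⁻ c, syncSpreadTime v c ∂(callListLaw G) := by
  classical
  have hpos : 0 < harmonic (Fintype.card V) := harmonic_pos Fintype.card_ne_zero
  have hH0 : H (Fintype.card V) ≠ 0 := by
    rw [H, Ne, ENNReal.ofReal_eq_zero, not_le]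
    exact_mod_cast hpos
  have hH1 : H (Fintype.card V) ≠ ⊤ := ENNReal.ofReal_ne_top
  -- `Z (W, c)` is the end of the phase whose number is the synchronous spread time with calls `c`
  let Z : (V → ℕ → ℝ) × (V × ℕ → V) → ℝ≥0∞ := fun p =>
    ⨅ k : ℕ, if ∀ u, u ∈ syncInformed p.2 v k then ENNReal.ofReal (phaseEnd k p.1) else ⊤
  have hZ : Measurable Z := Measurable.iInf fun k =>
    Measurable.ite (measurable_snd (measurableSet_syncInformed_all v k))
      ((measurable_phaseEnd k).comp measurable_fst).ennreal_ofReal measurable_const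
  calc ∫⁻ ω, asyncSpreadTime v ω ∂(asyncLaw G)
      ≤ ∫⁻ ω, Z ((fun x k => ω.1 (x, k) : V → ℕ → ℝ), phaseCalls (fun x k => ω.1 (x, k)) ω.2)
          ∂(asyncLaw G) := by
        refine lintegral_mono_ae ?_
        filter_upwards [ae_asyncLaw_iterate_nextClocks_pos G] with ω hω
        refine le_iInf fun k => ?_
        split_ifs with h
        · exact asyncSpreadTime_le_phaseEnd (fun _ _ => rfl) hω h
        · exact le_top
    _ = ∫⁻ p, Z p ∂((clocksLaw V).prod (callListLaw G)) :=
        (measurePreserving_phaseCalls G).lintegral_comp hZ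
    _ = ∫⁻ c, ∫⁻ W, Z (W, c) ∂(clocksLaw V) ∂(callListLaw G) :=
        lintegral_prod_symm _ hZ.aemeasurable
    _ ≤ ∫⁻ c, H (Fintype.card V) * syncSpreadTime v c ∂(callListLaw G) := by
        refine lintegral_mono fun c => ?_
        rw [syncSpreadTime]
        simp_rw [ENNReal.mul_iInf_of_ne hH0 hH1]
        refine le_iInf₂ fun k hk => le_trans (lintegral_mono fun W => ?_) (lintegral_phaseEnd_le k)
        exact (iInf_le _ k).trans (by rw [if_pos hk])
    _ = H (Fintype.card V) * ∫⁻ c, syncSpreadTime v c ∂(callListLaw G) :=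
        lintegral_const_mul' _ _ hH1

lemma asyncAverage_le (G : SimpleGraph V) :
    asyncAverage G ≤ H (Fintype.card V) * syncAverage G :=
  sInf_le fun v => (lintegral_asyncSpreadTime_le G v).trans <| by
    gcongr
    exact le_sInf fun t ht => ht v

/-- If the asynchronous spread time exceeds `τ`, then either `k` synchronous rounds with the
coupled calls do not suffice, or the first `k` phases last longer than `τ`; the latter is bounded
by an exponential moment. -/
lemma asyncLaw_lt_asyncSpreadTime_le (G : SimpleGraph V) (v : V) (k : ℕ) {τ : ℝ} (hτ : 0 ≤ τ) :
    asyncLaw G {ω | ENNReal.ofReal τ < asyncSpreadTime v ω} ≤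
      callListLaw G {c | ¬ ∀ u, u ∈ syncInformed c v k} +
        ENNReal.ofReal (Real.exp (-(3 / 4 * τ)) * (4 * Fintype.card V) ^ k) := by
  set A : Set (V × ℕ → V) := {c | ¬ ∀ u, u ∈ syncInformed c v k}
  set B : Set (V → ℕ → ℝ) := {W | τ < phaseEnd k W}
  have hA : MeasurableSet A := (measurableSet_syncInformed_all v k).compl
  have hB : MeasurableSet B := measurableSet_lt measurable_const (measurable_phaseEnd k)
  have hBle : clocksLaw V B ≤
      ENNReal.ofReal (Real.exp (-(3 / 4 * τ)) * (4 * Fintype.card V) ^ k) := by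
    have hm : Measurable fun W : V → ℕ → ℝ =>
        ENNReal.ofReal (Real.exp (3 / 4 * phaseEnd k W)) :=
      ((measurable_phaseEnd k).const_mul _).exp.ennreal_ofReal
    have h1 := meas_ge_le_lintegral_div (μ := clocksLaw V) hm.aemeasurable
      (ε := ENNReal.ofReal (Real.exp (3 / 4 * τ)))
      (by simpa using Real.exp_pos _) ENNReal.ofReal_ne_top
    refine le_trans (measure_mono fun W hW => ?_)
      (h1.trans (ENNReal.div_le_div_right (lintegral_exp_phaseEnd_le k) _))
      |>.trans_eq ?_
    · refine ENNReal.ofReal_le_ofReal (Real.exp_le_exp.2 ?_)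
      have : τ < phaseEnd k W := hW
      linarith
    · rw [ENNReal.ofReal_mul (Real.exp_pos _).le, Real.exp_neg,
        ENNReal.ofReal_inv_of_pos (Real.exp_pos _), ENNReal.div_eq_inv_mul,
        ENNReal.ofReal_pow (by positivity), ENNReal.ofReal_mul (by norm_num)]
      simp
  calc asyncLaw G {ω | ENNReal.ofReal τ < asyncSpreadTime v ω}
      ≤ asyncLaw G ((fun ω : (V × ℕ → ℝ) × (V × ℕ → V) =>
          ((fun x k => ω.1 (x, k) : V → ℕ → ℝ), phaseCalls (fun x k => ω.1 (x, k)) ω.2)) ⁻¹'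
          (Set.univ ×ˢ A ∪ B ×ˢ Set.univ)) := by
        refine measure_mono_ae ?_
        filter_upwards [ae_asyncLaw_iterate_nextClocks_pos G] with ω hω h
        by_cases hall : ∀ u, u ∈ syncInformed (phaseCalls (fun x k => ω.1 (x, k)) ω.2) v k
        · refine Or.inr ⟨?_, trivial⟩
          have h' : ENNReal.ofReal τ < asyncSpreadTime v ω := h
          have h1 := h'.trans_le (asyncSpreadTime_le_phaseEnd (fun _ _ => rfl) hω hall)
          exact (ENNReal.ofReal_lt_ofReal_iff_of_nonneg hτ).1 h1
        · exact Or.inl ⟨trivial, hall⟩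
    _ = ((clocksLaw V).prod (callListLaw G)) (Set.univ ×ˢ A ∪ B ×ˢ Set.univ) :=
        (measurePreserving_phaseCalls G).measure_preimage
          ((MeasurableSet.univ.prod hA).union (hB.prod .univ)).nullMeasurableSet
    _ ≤ callListLaw G A + clocksLaw V B := by
        refine (measure_union_le _ _).trans_eq ?_
        rw [Measure.prod_prod, Measure.prod_prod, measure_univ, measure_univ, one_mul, mul_one]
    _ ≤ _ := by gcongr

end Coupling

/-! ### The guaranteed spread time -/

section Guaranteed

variable {V : Type*} [Fintype V] [MeasurableSpace V]

/-- The guaranteed synchronous spread time may be rounded down to an integer. -/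
lemma exists_nat_le_syncGuaranteed {G : SimpleGraph V} (hg : syncGuaranteed G ≠ ⊤) :
    ∃ k : ℕ, (k : ℝ≥0∞) ≤ syncGuaranteed G ∧ ∀ v,
      callListLaw G {c | ¬ ∀ u, u ∈ syncInformed c v k} ≤ 1 / (Fintype.card V : ℝ≥0∞) := by
  obtain ⟨r, hr⟩ : ∃ r : ℝ≥0, (r : ℝ≥0∞) = syncGuaranteed G := ⟨_, ENNReal.coe_toNNReal hg⟩
  refine ⟨⌊r⌋₊, ?_, ?_⟩
  · rw [← hr]; exact_mod_cast Nat.floor_le r.2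
  · have hlt : syncGuaranteed G < (⌊r⌋₊ : ℝ≥0∞) + 1 := by
      rw [← hr]; exact_mod_cast Nat.lt_floor_add_one r
    obtain ⟨t, ht, htk⟩ := sInf_lt_iff.1 hlt
    exact fun v => le_trans (measure_mono fun c hc => htk.trans_le (le_syncSpreadTime hc)) (ht v)

variable [DiscreteMeasurableSpace V]

lemma callListLaw_not_all_one_of_card_eq_two {G : SimpleGraph V} (hG : G.Connected)
    (h2 : Fintype.card V = 2) (v : V) :
    callListLaw G {c | ¬ ∀ u, u ∈ syncInformed c v 1} = 0 := by
  have : Nontrivial V := Fintype.one_lt_card_iff_nontrivial.1 (by omega)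
  refine ae_iff.1 ?_
  filter_upwards [ae_callListLaw_adj fun x => hG.preconnected.exists_adj_of_nontrivial x] with c hc u
  by_cases hu : u = v
  · exact Or.inl hu
  · refine Or.inr (Or.inl ⟨v, rfl, ?_⟩)
    by_contra h
    have := (Fintype.two_lt_card_iff (α := V)).2 ⟨u, v, c (v, 0), hu, Ne.symm h, (hc (v, 0)).ne⟩
    omega

/-- The numerical estimate behind the constant 8: with the exponential moment of order `3 / 4` the
first summand is `(16 / n ^ 4) ^ k`. -/
lemma exp_mul_pow_add_sq_le {n : ℝ} (hn : 3 ≤ n) {k : ℕ} (hk : 1 ≤ k) :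
    Real.exp (-(3 / 4 * (8 * k * Real.log n))) * (4 * n) ^ (k + k) + (1 / n) ^ 2 ≤ 1 / n := by
  have h0 : 0 < n := by linarith
  have h1 : Real.exp (-(3 / 4 * (8 * k * Real.log n))) * (4 * n) ^ (k + k)
      = (16 / n ^ 4) ^ k := by
    have : -(3 / 4 * (8 * k * Real.log n)) = (k : ℝ) * (-(6 * Real.log n)) := by ring
    rw [this, Real.exp_nat_mul, ← two_mul, pow_mul, ← mul_pow]
    congr 1
    have h6 : (6 : ℝ) * Real.log n = Real.log (n ^ 6) := by rw [Real.log_pow]; norm_num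
    rw [h6, Real.exp_neg, Real.exp_log (by positivity)]
    field_simp
    norm_num
  have h3 : 16 / n ^ 4 ≤ 1 := by
    rw [div_le_one (by positivity)]
    nlinarith [pow_le_pow_left₀ (by norm_num) hn 4]
  have h4 : (16 / n ^ 4) ^ k ≤ 16 / n ^ 4 := by
    calc (16 / n ^ 4) ^ k ≤ (16 / n ^ 4) ^ 1 := pow_le_pow_of_le_one (by positivity) h3 hk
      _ = 16 / n ^ 4 := pow_one _
  have h5 : 16 / n ^ 4 + (1 / n) ^ 2 ≤ 1 / n := by
    have : 1 / n - (1 / n) ^ 2 - 16 / n ^ 4 = (n ^ 3 - n ^ 2 - 16) / n ^ 4 := by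
      field_simp
    have h6 : 0 ≤ n ^ 3 - n ^ 2 - 16 := by nlinarith [mul_nonneg h0.le (sub_nonneg.2 hn)]
    have := div_nonneg h6 (by positivity : 0 ≤ n ^ 4)
    linarith
  rw [h1]
  linarith

/-- Two runs of the synchronous protocol bring its failure probability down to `1 / n ^ 2`, which
leaves room for the probability that the corresponding phases last too long. On two vertices this
room is too small, but there a single round suffices. -/
lemma asyncGuaranteed_le {G : SimpleGraph V} (hG : G.Connected) :
    asyncGuaranteed G ≤ 8 * syncGuaranteed G * logN (Fintype.card V) := by
  have : Nonempty V := hG.nonempty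
  set n := Fintype.card V with hn
  have hn0 : 0 < n := Fintype.card_pos
  rcases (show n = 1 ∨ 2 ≤ n by omega) with h1 | h2
  · refine (sInf_le fun v => ?_).trans (zero_le (a := 8 * syncGuaranteed G * logN n))
    rw [← hn, h1]
    simpa using prob_le_one
  have hlog : 0 < Real.log n := Real.log_pos (by exact_mod_cast h2)
  by_cases hg : syncGuaranteed G = ⊤
  · have : logN n ≠ 0 := by simpa [logN] using hlog
    rw [hg, ENNReal.mul_top (by norm_num), ENNReal.top_mul this]
    exact le_top
  obtain ⟨k, hkg, hk⟩ := exists_nat_le_syncGuaranteed hg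
  rw [← hn] at hk
  have hninv : (1 : ℝ≥0∞) / n = ENNReal.ofReal (1 / n) := by
    rw [ENNReal.ofReal_div_of_pos (by exact_mod_cast hn0)]; simp
  have hk1 : 1 ≤ k := by
    by_contra h0
    obtain rfl : k = 0 := by omega
    obtain ⟨v, u, hvu⟩ := (Fintype.one_lt_card_iff (α := V)).1 (by omega)
    have h := hk v
    have huniv : {c : V × ℕ → V | ¬ ∀ u, u ∈ syncInformed c v 0} = Set.univ :=
      Set.eq_univ_of_forall fun c hc => hvu (hc u).symm
    rw [huniv, measure_univ, hninv, ← ENNReal.ofReal_one,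
      ENNReal.ofReal_le_ofReal_iff (by positivity), le_div_iff₀ (by positivity)] at h
    have : (2 : ℝ) ≤ n := by exact_mod_cast h2
    linarith
  have hτ : 0 ≤ 8 * k * Real.log n := by positivity
  refine sInf_le fun v => ?_
  have hle : ENNReal.ofReal (8 * k * Real.log n) ≤ 8 * syncGuaranteed G * logN n := by
    rw [ENNReal.ofReal_mul (by positivity), ENNReal.ofReal_mul (by norm_num), logN]
    gcongr
    · simp
    · simpa using hkg
  refine le_trans (measure_mono fun ω hω => lt_of_le_of_lt hle hω) ?_
  rw [← hn, hninv]
  rcases (show n = 2 ∨ 3 ≤ n by omega) with h | h3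
  · refine (asyncLaw_lt_asyncSpreadTime_le G v 1 hτ).trans ?_
    rw [callListLaw_not_all_one_of_card_eq_two hG (hn ▸ h), zero_add, ← hn, h]
    refine ENNReal.ofReal_le_ofReal ?_
    have hk1' : (1 : ℝ) ≤ k := by exact_mod_cast hk1
    have hlog2 : 0 < Real.log 2 := Real.log_pos (by norm_num)
    have h6 : Real.exp (-(3 / 4 * (8 * k * Real.log 2))) ≤ Real.exp (-Real.log (2 ^ 6)) := by
      refine Real.exp_le_exp.2 (neg_le_neg ?_)
      rw [Real.log_pow]
      push_cast
      nlinarith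
    rw [Real.exp_neg (Real.log _), Real.exp_log (by norm_num)] at h6
    push_cast
    linarith
  · refine (asyncLaw_lt_asyncSpreadTime_le G v (k + k) hτ).trans ?_
    have hsq : callListLaw G {c | ¬ ∀ u, u ∈ syncInformed c v (k + k)}
        ≤ ENNReal.ofReal ((1 / n) ^ 2) := by
      refine (callListLaw_not_all_two_mul_le G v k).trans ?_
      rw [ENNReal.ofReal_pow (by positivity), ← hninv]
      gcongr
      exact hk v
    refine (add_le_add_left hsq _).trans ?_
    rw [← hn, ← ENNReal.ofReal_add (by positivity) (by positivity), add_comm]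
    exact ENNReal.ofReal_le_ofReal (exp_mul_pow_add_sq_le (by exact_mod_cast h3) hk1)

end Guaranteed

/-! ### The star -/

section Star

lemma starOn_adj {n : ℕ} {x y : Fin (n + 1)} :
    (starOn n).Adj x y ↔ x ≠ y ∧ (x = 0 ∨ y = 0) := by
  simp [starOn]

lemma ae_callListLaw_starOn {n : ℕ} (hn : 1 ≤ n) :
    ∀ᵐ c ∂(callListLaw (starOn n)), ∀ x ≠ 0, ∀ k, c (x, k) = 0 := by
  have hadj : ∀ x, ∃ y, (starOn n).Adj x y := fun x => by
    by_cases hx : x = 0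
    · exact ⟨Fin.last n, starOn_adj.2 ⟨by
        rw [hx, Ne, Fin.ext_iff]; simp; omega, Or.inl hx⟩⟩
    · exact ⟨0, starOn_adj.2 ⟨hx, Or.inr rfl⟩⟩
  filter_upwards [ae_callListLaw_adj hadj] with c hc x hx k
  exact (starOn_adj.1 (hc (x, k))).2.resolve_left hx

lemma ae_syncSpreadTime_starOn_le {n : ℕ} (hn : 1 ≤ n) (v : Fin (n + 1)) :
    ∀ᵐ c ∂(callListLaw (starOn n)), syncSpreadTime v c ≤ 2 := by
  filter_upwards [ae_callListLaw_starOn hn] with c hc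
  have h0 : (0 : Fin (n + 1)) ∈ syncInformed c v 1 := by
    by_cases hv : v = 0
    · rw [hv]; exact source_mem_syncInformed c 0 1
    · exact Or.inr (Or.inl ⟨v, rfl, hc v hv 0⟩)
  refine syncSpreadTime_le (k := 2) fun u => ?_
  by_cases hu : u = 0
  · rw [hu]; exact syncInformed_mono c v one_le_two h0
  · exact Or.inr (Or.inr (by rw [hc u hu 1]; exact h0))

lemma syncAverage_starOn_le {n : ℕ} (hn : 1 ≤ n) : syncAverage (starOn n) ≤ 2 :=
  sInf_le fun v => (lintegral_mono_ae (ae_syncSpreadTime_starOn_le hn v)).trans (by simp)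

lemma syncGuaranteed_starOn_le {n : ℕ} (hn : 1 ≤ n) : syncGuaranteed (starOn n) ≤ 2 :=
  sInf_le fun v => by
    have h := ae_syncSpreadTime_starOn_le hn v
    rw [ae_iff] at h
    simp only [not_le] at h
    rw [h]
    exact zero_le

/-- A leaf whose clock has not rung up to time `t` can only be informed by a call of the centre.
If the centre rings at most `m` times up to time `t` and its first `m` calls miss the leaf, then
the leaf is not informed at time `t`. -/
lemma ne_of_asyncKnows_star {n m : ℕ} {w : Fin (n + 1) × ℕ → ℝ}
    {c : Fin (n + 1) × ℕ → Fin (n + 1)} {t : ℝ} {u : Fin (n + 1)} (hw : ∀ p, 0 ≤ w p)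
    (hc : ∀ x ≠ 0, ∀ k, c (x, k) = 0) (hu : u ≠ 0) (hm : t < ringTime w 0 m)
    (hmiss : ∀ i < m, c (0, i) ≠ u) (hring : t < w (u, 0)) {x : Fin (n + 1)} {r : ℝ}
    (h : AsyncKnows w c 0 x r) (hr : r ≤ t) : x ≠ u := by
  have hmono : ∀ x, Monotone (ringTime w x) := fun x =>
    seqRing_mono (u := fun i => w (x, i)) fun i => hw _
  cases h with
  | source => exact hu.symm
  | @push x k _ _ _ _ h2 =>
    by_cases hx : x = 0
    · subst hx
      refine hmiss k (lt_of_not_ge fun hmk => ?_)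
      linarith [hmono 0 hmk]
    · rw [hc x hx]; exact hu.symm
  | @pull _ k _ _ _ _ h2 =>
    rintro rfl
    have h3 := hmono x (Nat.zero_le k)
    have h4 : ringTime w x 0 = w (x, 0) := by simp [ringTime]
    linarith

lemma clocksLaw_inter_pi {V : Type*} [Fintype V] {z : V} {U : Finset V} (hz : z ∉ U)
    (A B : Set (ℕ → ℝ)) :
    clocksLaw V {W | W z ∈ A ∧ ∀ u ∈ U, W u ∈ B} = waitLaw A * waitLaw B ^ U.card := by
  classical
  have h : {W : V → ℕ → ℝ | W z ∈ A ∧ ∀ u ∈ U, W u ∈ B} =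
      Set.univ.pi fun x => if x = z then A else if x ∈ U then B else Set.univ := by
    ext W
    simp only [Set.mem_ofPred_eq, Set.mem_univ_pi]
    constructor
    · rintro ⟨h1, h2⟩ x
      split_ifs with h3 h4
      · exact h3 ▸ h1
      · exact h2 x h4
      · trivial
    · intro h
      refine ⟨by simpa using h z, fun u hu => ?_⟩
      have hne : u ≠ z := fun h' => hz (h' ▸ hu)
      simpa [hne, hu] using h u
  rw [h, clocksLaw, Measure.pi_pi, ← Finset.mul_prod_erase _ _ (Finset.mem_univ z), if_pos rfl]
  congr 1
  rw [← Finset.prod_const]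
  have hU : U ⊆ Finset.univ.erase z := fun u hu =>
    Finset.mem_erase.2 ⟨fun h' => hz (h' ▸ hu), Finset.mem_univ u⟩
  rw [← Finset.prod_subset hU fun x hx hxU => by
    rw [if_neg (Finset.ne_of_mem_erase hx), if_neg hxU, measure_univ]]
  exact Finset.prod_congr rfl fun u hu => by
    rw [if_neg (Finset.ne_of_mem_erase (hU hu)), if_pos hu]

lemma waitLaw_first (S : Set ℝ) (hS : MeasurableSet S) :
    waitLaw {u | u 0 ∈ S} = expMeasure 1 S :=
  (measurePreserving_eval_infinitePi (fun _ : ℕ => expMeasure 1) 0).measure_preimage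
    hS.nullMeasurableSet

lemma lintegral_exp_neg_seqRing (m : ℕ) :
    ∫⁻ u, ENNReal.ofReal (Real.exp (-seqRing u m)) ∂waitLaw = 2⁻¹ ^ (m + 1) := by
  have hm : ∀ m, Measurable fun u : ℕ → ℝ => ENNReal.ofReal (Real.exp (-seqRing u m)) := fun m =>
    (measurable_seqRing m).neg.exp.ennreal_ofReal
  have he : Measurable fun a : ℝ => ENNReal.ofReal (Real.exp (-a)) := by fun_prop
  induction m with
  | zero =>
    simp only [seqRing_zero, zero_add, pow_one]
    rw [← lintegral_exp_neg]
    exact (measurePreserving_eval_infinitePi (fun _ : ℕ => expMeasure 1) 0).lintegral_comp he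
  | succ m ih =>
    rw [← measurePreserving_consSeq.lintegral_comp (hm _), pow_succ', ← ih, ← lintegral_exp_neg,
      ← lintegral_prod_mul he.aemeasurable (hm m).aemeasurable]
    refine lintegral_congr fun p => ?_
    rw [seqRing_consSeq_succ, neg_add, Real.exp_add, ENNReal.ofReal_mul (Real.exp_pos _).le]

/-- Markov's inequality for `exp (-S)`, where `S` is the sum of the first `m + 1` waiting times. -/
lemma waitLaw_lt_seqRing_ge (t : ℝ) (m : ℕ) :
    ENNReal.ofReal (1 - Real.exp t / 2 ^ (m + 1)) ≤ waitLaw {u | t < seqRing u m} := by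
  have hms : MeasurableSet {u : ℕ → ℝ | seqRing u m ≤ t} :=
    measurableSet_le (measurable_seqRing m) measurable_const
  have h1 : waitLaw {u | seqRing u m ≤ t} ≤ ENNReal.ofReal (Real.exp t / 2 ^ (m + 1)) := by
    have h := meas_ge_le_lintegral_div (μ := waitLaw)
      (f := fun u : ℕ → ℝ => ENNReal.ofReal (Real.exp (-seqRing u m)))
      (measurable_seqRing m).neg.exp.ennreal_ofReal.aemeasurable
      (ε := ENNReal.ofReal (Real.exp (-t))) (by simpa using Real.exp_pos _) ENNReal.ofReal_ne_top
    rw [lintegral_exp_neg_seqRing] at h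
    refine le_trans (measure_mono fun u hu => ?_) (h.trans_eq ?_)
    · have : seqRing u m ≤ t := hu
      exact ENNReal.ofReal_le_ofReal (Real.exp_le_exp.2 (by linarith))
    · rw [ENNReal.ofReal_div_of_pos (by positivity), Real.exp_neg,
        ENNReal.ofReal_inv_of_pos (Real.exp_pos t), ENNReal.div_eq_inv_mul, inv_inv,
        ENNReal.ofReal_pow (by norm_num), div_eq_mul_inv, ENNReal.inv_pow]
      simp
  have h2 : {u : ℕ → ℝ | t < seqRing u m} = {u | seqRing u m ≤ t}ᶜ := by ext u; simp
  rw [h2, prob_compl_eq_one_sub hms, ENNReal.ofReal_sub _ (by positivity), ENNReal.ofReal_one]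
  exact tsub_le_tsub_left h1 1

/-- Lower tail bound for the star: the number of rings of the centre, its calls, and the first
rings of the leaves which it misses are independent. -/
lemma exists_asyncLaw_starOn_ge {n : ℕ} (hn : 1 ≤ n) (m : ℕ) {t : ℝ} (ht : 0 ≤ t) :
    ∃ E, MeasurableSet E ∧
      waitLaw {u | t < seqRing u m} * ENNReal.ofReal (1 - (1 - Real.exp (-t)) ^ (n - m)) ≤
        asyncLaw (starOn n) E ∧
      ∀ᵐ ω ∂(asyncLaw (starOn n)), ω ∈ E → ENNReal.ofReal t ≤ asyncSpreadTime 0 ω := by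
  classical
  have hb0 : 0 ≤ 1 - Real.exp (-t) := by simpa using ht
  have hb1 : 1 - Real.exp (-t) ≤ 1 := by linarith [Real.exp_pos (-t)]
  -- `U c` is the set of leaves missed by the first `m` calls of the centre
  let U : (Fin (n + 1) × ℕ → Fin (n + 1)) → Finset (Fin (n + 1)) := fun c =>
    Finset.univ.erase 0 \ (Finset.range m).image fun i => c (0, i)
  have hU0 : ∀ c, (0 : Fin (n + 1)) ∉ U c := fun c => by simp [U]
  have hUcard : ∀ c, n - m ≤ (U c).card := fun c => by
    have h1 := Finset.le_card_sdiff ((Finset.range m).image fun i => c (0, i))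
      (Finset.univ.erase (0 : Fin (n + 1)))
    have h2 : ((Finset.range m).image fun i => c (0, i)).card ≤ m := by
      simpa using Finset.card_image_le (s := Finset.range m) (f := fun i => c (0, i))
    have h3 : (Finset.univ.erase (0 : Fin (n + 1))).card = n := by simp
    simp only [U]
    omega
  have hUmem : ∀ c u, u ∈ U c ↔ u ≠ 0 ∧ ∀ i < m, c (0, i) ≠ u := fun c u => by
    simp [U]
  let E : Set ((Fin (n + 1) × ℕ → ℝ) × (Fin (n + 1) × ℕ → Fin (n + 1))) :=
    {ω | t < ringTime ω.1 0 m ∧ ∃ u ∈ U ω.2, t < ω.1 (u, 0)}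
  have hE : MeasurableSet E := by
    have hring : Measurable fun w : Fin (n + 1) × ℕ → ℝ => ringTime w 0 m := by
      unfold ringTime; fun_prop
    have h : E = {ω | t < ringTime ω.1 0 m} ∩
        ⋃ u, {ω | u ≠ 0} ∩ (⋂ i, {ω | i < m → ω.2 (0, i) ≠ u}) ∩ {ω | t < ω.1 (u, 0)} := by
      ext ω
      simp [E, hUmem]
    rw [h]
    refine (measurableSet_lt measurable_const (hring.comp measurable_fst)).inter
      (.iUnion fun u => ((MeasurableSet.const _).inter (.iInter fun i => ?_)).inter
        (measurableSet_lt measurable_const ((measurable_pi_apply _).comp measurable_fst)))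
    by_cases hi : i < m
    · simp only [hi, true_imp_iff]
      exact (measurableSet_eq_fun ((measurable_pi_apply (0, i)).comp measurable_snd)
        measurable_const).compl
    · simp [hi]
  set A : Set (ℕ → ℝ) := {u | t < seqRing u m} with hA
  have hAm : MeasurableSet A := measurableSet_lt measurable_const (measurable_seqRing m)
  have hfib : ∀ c, waitLaw A * ENNReal.ofReal (1 - (1 - Real.exp (-t)) ^ (n - m)) ≤
      clockLaw (Fin (n + 1)) ((fun w => (w, c)) ⁻¹' E) := fun c => by
    set R : Finset (Fin (n + 1)) → Set (Fin (n + 1) → ℕ → ℝ) := fun U =>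
      {W | W 0 ∈ A ∧ ∀ u ∈ U, W u ∈ {s : ℕ → ℝ | s 0 ∈ Set.Iic t}} with hR
    have hRm : ∀ U, MeasurableSet (R U) := fun U => by
      have h0 : MeasurableSet ((fun W : Fin (n + 1) → ℕ → ℝ => W 0) ⁻¹' A) :=
        measurable_pi_apply 0 hAm
      refine h0.inter ?_
      show MeasurableSet {W : Fin (n + 1) → ℕ → ℝ | ∀ u ∈ U, W u 0 ∈ Set.Iic t}
      simp only [Set.ofPred_forall]
      exact .iInter fun u => .iInter fun _ =>
        measurableSet_le (f := fun W : Fin (n + 1) → ℕ → ℝ => W u 0) (by fun_prop) measurable_const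
    have hpre : (fun w => (w, c)) ⁻¹' E =
        (fun (w : Fin (n + 1) × ℕ → ℝ) x k => w (x, k)) ⁻¹' (R ∅ \ R (U c)) := by
      ext w
      have hrt : seqRing (fun k => w (0, k)) m = ringTime w 0 m := rfl
      simp only [E, hR, hA, Set.mem_preimage, Set.mem_ofPred_eq, Set.mem_sdiff, hrt, Set.mem_Iic]
      grind
    have hsub : R (U c) ⊆ R ∅ := fun W hW => ⟨hW.1, by simp⟩
    rw [hpre, measurePreserving_curry.measure_preimage
      ((hRm _).diff (hRm _)).nullMeasurableSet, measure_sdiff hsub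
      (hRm _).nullMeasurableSet (measure_ne_top _ _), clocksLaw_inter_pi (by simp),
      clocksLaw_inter_pi (hU0 c), waitLaw_first _ measurableSet_Iic, expMeasure_one_Iic ht,
      Finset.card_empty, pow_zero, ← ENNReal.mul_sub (fun _ _ => measure_ne_top _ _),
      ← ENNReal.ofReal_pow hb0, ← ENNReal.ofReal_one, ← ENNReal.ofReal_sub _ (pow_nonneg hb0 _)]
    exact mul_le_mul' le_rfl (ENNReal.ofReal_le_ofReal
      (sub_le_sub_left (pow_le_pow_of_le_one hb0 hb1 (hUcard c)) 1))
  refine ⟨E, hE, ?_, ?_⟩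
  · calc waitLaw A * ENNReal.ofReal (1 - (1 - Real.exp (-t)) ^ (n - m))
        = ∫⁻ _c, waitLaw A * ENNReal.ofReal (1 - (1 - Real.exp (-t)) ^ (n - m))
            ∂(callListLaw (starOn n)) := by simp
      _ ≤ ∫⁻ c, clockLaw (Fin (n + 1)) ((fun w => (w, c)) ⁻¹' E) ∂(callListLaw (starOn n)) :=
          lintegral_mono hfib
      _ = asyncLaw (starOn n) E := (Measure.prod_apply_symm hE).symm
  · have hc := (measurePreserving_snd (μ := clockLaw (Fin (n + 1)))
      (ν := callListLaw (starOn n))).quasiMeasurePreserving.ae (ae_callListLaw_starOn hn)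
    have hw := (measurePreserving_curry.comp (measurePreserving_fst
      (μ := clockLaw (Fin (n + 1))) (ν := callListLaw (starOn n)))).quasiMeasurePreserving.ae
      ae_clocksLaw_pos
    filter_upwards [hc, hw] with ω hc hw hω
    obtain ⟨h1, u, hu, h2⟩ := hω
    obtain ⟨hu0, hmiss⟩ := (hUmem _ _).1 hu
    refine le_iInf₂ fun s hs => ?_
    by_contra hst
    have hst' : (s : ℝ) ≤ t := by
      have := ENNReal.lt_ofReal_iff_toReal_lt ENNReal.coe_ne_top |>.1 (not_le.1 hst)
      simpa using this.le
    exact ne_of_asyncKnows_star (fun p => (hw p.1 p.2).le) hc hu0 h1 hmiss h2 (hs u) hst' rfl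

/-- The guaranteed asynchronous spread time of the star: already the clocks of the centre and of
one leaf both stay silent up to time `t` with probability `exp (-2 * t)`. -/
lemma le_asyncGuaranteed_starOn {n : ℕ} (hn : 1 ≤ n) :
    ENNReal.ofReal (Real.log (n + 1) / 2) ≤ asyncGuaranteed (starOn n) := by
  refine le_sInf fun T hT => ?_
  by_contra hlt
  obtain ⟨r, hTr, hr⟩ := ENNReal.lt_iff_exists_nnreal_btwn.1 (not_le.1 hlt)
  have hr' : (r : ℝ) < Real.log (n + 1) / 2 := by
    simpa using ENNReal.lt_ofReal_iff_toReal_lt ENNReal.coe_ne_top |>.1 hr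
  obtain ⟨E, -, h1, hE⟩ := exists_asyncLaw_starOn_ge hn 0 r.coe_nonneg
  have h2 : waitLaw {u | (r : ℝ) < seqRing u 0} = ENNReal.ofReal (Real.exp (-r)) := by
    simp only [seqRing_zero]
    rw [← expMeasure_one_Ioi r.coe_nonneg, ← waitLaw_first _ measurableSet_Ioi]
    rfl
  have h3 : asyncLaw (starOn n) E ≤ 1 / (Fintype.card (Fin (n + 1)) : ℝ≥0∞) := by
    refine le_trans (measure_mono_ae ?_) (hT 0)
    filter_upwards [hE] with ω hω hωE
    have h := hω hωE
    rw [ENNReal.ofReal_coe_nnreal] at h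
    exact hTr.trans_le h
  have h4 := h1.trans h3
  have hb0 : 0 ≤ 1 - Real.exp (-r) := by simp
  have hb1 : 1 - Real.exp (-r) ≤ 1 := by linarith [Real.exp_pos (-r)]
  have h5 : Real.exp (-r) ≤ 1 - (1 - Real.exp (-r)) ^ (n - 0) := by
    have : (1 - Real.exp (-r)) ^ (n - 0) ≤ (1 - Real.exp (-r)) ^ 1 :=
      pow_le_pow_of_le_one hb0 hb1 (by omega)
    linarith
  have hcard : (1 : ℝ≥0∞) / (Fintype.card (Fin (n + 1)) : ℝ≥0∞)
      = ENNReal.ofReal (1 / ((n : ℝ) + 1)) := by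
    rw [ENNReal.ofReal_div_of_pos (by positivity), Fintype.card_fin,
      ENNReal.ofReal_add (by positivity) (by norm_num)]
    simp
  rw [h2, hcard, ← ENNReal.ofReal_mul (Real.exp_pos _).le,
    ENNReal.ofReal_le_ofReal_iff (by positivity)] at h4
  have h6 : Real.exp (-r) * Real.exp (-r) ≤ 1 / ((n : ℝ) + 1) :=
    le_trans (mul_le_mul_of_nonneg_left h5 (Real.exp_pos _).le) h4
  have h7 : 1 / ((n : ℝ) + 1) < Real.exp (-r) * Real.exp (-r) := by
    rw [← Real.exp_add, one_div, ← Real.exp_log (by positivity : (0 : ℝ) < n + 1), ← Real.exp_neg,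
      Real.exp_lt_exp]
    linarith
  linarith

lemma one_sub_pow_mul_ge {n : ℕ} (hn : 1 ≤ n) {y : ℝ} (hy0 : 0 < y) (hy : y ^ 4 = n + 1) :
    2 / 25 ≤ (1 - y / 2 ^ (n / 2 + 1)) * (1 - (1 - y⁻¹) ^ (n - n / 2)) := by
  have hn1 : (1 : ℝ) ≤ n := by exact_mod_cast hn
  have hy1 : 1 ≤ y := by
    by_contra h
    have := pow_lt_one₀ hy0.le (not_le.1 h) (n := 4) (by norm_num)
    linarith
  have hbern : ∀ k : ℕ, 2 ≤ k → 2 * k ≤ 2 ^ k := fun k hk => by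
    induction k, hk using Nat.le_induction with
    | base => norm_num
    | succ k hk ih => rw [pow_succ]; omega
  -- the centre: `(n + 1) * 8 ≤ 4 ^ (n + 1) ≤ (2 ^ (n / 2 + 1)) ^ 4`
  have h1 : y / 2 ^ (n / 2 + 1) ≤ 3 / 5 := by
    rw [div_le_iff₀ (by positivity)]
    refine le_of_pow_le_pow_left₀ (n := 4) (by norm_num) (by positivity) ?_
    have hb : 8 * (n + 1) ≤ (2 ^ (n / 2 + 1)) ^ 4 := by
      have h2 := hbern (n + 1) (by omega)
      calc 8 * (n + 1) ≤ (2 * (n + 1)) ^ 2 := by nlinarith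
        _ ≤ (2 ^ (n + 1)) ^ 2 := Nat.pow_le_pow_left h2 2
        _ = 2 ^ ((n + 1) * 2) := (pow_mul _ _ _).symm
        _ ≤ 2 ^ ((n / 2 + 1) * 4) := Nat.pow_le_pow_right (by norm_num) (by omega)
        _ = (2 ^ (n / 2 + 1)) ^ 4 := pow_mul _ _ _
    have hb' : (8 : ℝ) * (n + 1) ≤ (2 ^ (n / 2 + 1)) ^ 4 := by exact_mod_cast hb
    rw [hy, mul_pow]
    nlinarith
  -- the leaves: `(1 - x) ^ k ≤ (1 + x) ^ (-k) ≤ 1 / (1 + k * x)` with `k * x ≥ 1 / 4`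
  have h2 : (1 - y⁻¹) ^ (n - n / 2) ≤ 4 / 5 := by
    set k := n - n / 2 with hk
    have hx1 : y⁻¹ ≤ 1 := inv_le_one_of_one_le₀ hy1
    have hx0 : 0 < y⁻¹ := inv_pos.2 hy0
    have hkn : (n : ℝ) + 1 ≤ 4 * k := by
      have : n + 1 ≤ 4 * k := by omega
      exact_mod_cast this
    have hkx : 1 / 4 ≤ k * y⁻¹ := by
      rw [← div_eq_mul_inv, le_div_iff₀ hy0]
      have : y ≤ y ^ 4 := le_self_pow₀ hy1 (by norm_num)
      linarith
    have hB := one_add_mul_le_pow (a := y⁻¹) (by linarith) k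
    have hprod : (1 - y⁻¹) ^ k * (1 + y⁻¹) ^ k ≤ 1 := by
      rw [← mul_pow]
      refine pow_le_one₀ (by nlinarith) (by nlinarith)
    have hp0 : 0 ≤ (1 - y⁻¹) ^ k := pow_nonneg (by linarith) _
    nlinarith
  calc (2 : ℝ) / 25 = 2 / 5 * (1 / 5) := by norm_num
    _ ≤ _ := mul_le_mul (by linarith) (by linarith) (by norm_num) (by linarith)

/-- The mean asynchronous spread time of the star is at least of order `log n`: up to time
`log (n + 1) / 4` the centre is unlikely to ring more than `n / 2` times, and among the remaining
`n / 2` leaves some clock is likely to stay silent. -/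
lemma le_asyncAverage_starOn {n : ℕ} (hn : 1 ≤ n) :
    ENNReal.ofReal (Real.log (n + 1) / 50) ≤ asyncAverage (starOn n) := by
  set t := Real.log (n + 1) / 4 with ht
  have hn1 : (1 : ℝ) ≤ n := by exact_mod_cast hn
  have ht0 : 0 ≤ t := div_nonneg (Real.log_nonneg (by linarith)) (by norm_num)
  have hy : Real.exp t ^ 4 = n + 1 := by
    rw [← Real.exp_nat_mul, ht]
    push_cast
    rw [mul_div_cancel₀ _ (by norm_num), Real.exp_log (by positivity)]
  obtain ⟨E, hEm, hE, hEt⟩ := exists_asyncLaw_starOn_ge hn (n / 2) ht0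
  have hprob : ENNReal.ofReal (2 / 25) ≤ asyncLaw (starOn n) E := by
    refine le_trans ?_ hE
    have hb : 0 ≤ 1 - (1 - Real.exp (-t)) ^ (n - n / 2) :=
      sub_nonneg.2 (pow_le_one₀ (by simpa using ht0) (by linarith [Real.exp_pos (-t)]))
    refine le_trans ?_ (mul_le_mul_left (waitLaw_lt_seqRing_ge t (n / 2)) _)
    rw [← ENNReal.ofReal_mul' hb]
    refine ENNReal.ofReal_le_ofReal ?_
    rw [Real.exp_neg]
    exact one_sub_pow_mul_ge hn (Real.exp_pos t) hy
  refine le_sInf fun T hT => le_trans ?_ (hT 0)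
  calc ENNReal.ofReal (Real.log (n + 1) / 50)
      = ENNReal.ofReal t * ENNReal.ofReal (2 / 25) := by
        rw [← ENNReal.ofReal_mul ht0, ht]; congr 1; ring
    _ ≤ ENNReal.ofReal t * asyncLaw (starOn n) E := by gcongr
    _ = ∫⁻ ω, E.indicator (fun _ => ENNReal.ofReal t) ω ∂(asyncLaw (starOn n)) :=
        (lintegral_indicator_const hEm _).symm
    _ ≤ ∫⁻ ω, asyncSpreadTime 0 ω ∂(asyncLaw (starOn n)) := by
        refine lintegral_mono_ae ?_
        filter_upwards [hEt] with ω hω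
        by_cases h : ω ∈ E
        · rw [Set.indicator_of_mem h]; exact hω h
        · rw [Set.indicator_of_notMem h]; exact zero_le

end Star

lemma H_mul_syncAverage_starOn_le {n : ℕ} (hn : 1 ≤ n) :
    ENNReal.ofReal (1 / 300) * (H (n + 1) * syncAverage (starOn n)) ≤ asyncAverage (starOn n) := by
  have hH : (harmonic (n + 1) : ℝ) ≤ 3 * Real.log (n + 1) := by
    have h1 := harmonic_le_one_add_log (n + 1)
    have h2 : Real.log 2 ≤ Real.log (n + 1) :=
      Real.log_le_log (by norm_num) (by have : (1 : ℝ) ≤ n := by exact_mod_cast hn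
                                        linarith)
    have h3 := Real.log_two_gt_d9
    push_cast at h1
    linarith
  calc ENNReal.ofReal (1 / 300) * (H (n + 1) * syncAverage (starOn n))
      ≤ ENNReal.ofReal (1 / 300) * (ENNReal.ofReal (3 * Real.log (n + 1)) * 2) := by
        gcongr
        · exact ENNReal.ofReal_le_ofReal hH
        · exact syncAverage_starOn_le hn
    _ = ENNReal.ofReal (Real.log (n + 1) / 50) := by
        rw [← ENNReal.ofReal_ofNat 2, ← ENNReal.ofReal_mul' (by norm_num),
          ← ENNReal.ofReal_mul (by norm_num)]
        congr 1; ring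
    _ ≤ asyncAverage (starOn n) := le_asyncAverage_starOn hn

lemma syncGuaranteed_starOn_mul_logN_le {n : ℕ} (hn : 1 ≤ n) :
    ENNReal.ofReal (1 / 300) * (syncGuaranteed (starOn n) * logN (n + 1)) ≤
      asyncGuaranteed (starOn n) := by
  have hlog : 0 ≤ Real.log (n + 1) := Real.log_nonneg (by simp)
  calc ENNReal.ofReal (1 / 300) * (syncGuaranteed (starOn n) * logN (n + 1))
      ≤ ENNReal.ofReal (1 / 300) * (2 * ENNReal.ofReal (Real.log (n + 1))) := by
        gcongr
        · exact syncGuaranteed_starOn_le hn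
        · rw [logN]; push_cast; rfl
    _ = ENNReal.ofReal (1 / 300 * (2 * Real.log (n + 1))) := by
        rw [← ENNReal.ofReal_ofNat 2, ← ENNReal.ofReal_mul (by norm_num),
          ← ENNReal.ofReal_mul (by norm_num)]
    _ ≤ ENNReal.ofReal (Real.log (n + 1) / 2) := ENNReal.ofReal_le_ofReal (by linarith)
    _ ≤ asyncGuaranteed (starOn n) := le_asyncGuaranteed_starOn hn

end RumourSpreading

open RumourSpreading in
theorem theorem3 :
    (∀ {V : Type*} [Fintype V] [MeasurableSpace V] [DiscreteMeasurableSpace V]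
      (G : SimpleGraph V), G.Connected →
        asyncAverage G ≤ H (Fintype.card V) * syncAverage G ∧
        asyncGuaranteed G ≤ 8 * syncGuaranteed G * logN (Fintype.card V)) ∧
    ∃ c : ℝ, 0 < c ∧ ∀ n : ℕ, 1 ≤ n →
        ENNReal.ofReal c * (H (n + 1) * syncAverage (starOn n)) ≤ asyncAverage (starOn n) ∧
        ENNReal.ofReal c * (syncGuaranteed (starOn n) * logN (n + 1)) ≤
          asyncGuaranteed (starOn n) := by
  refine ⟨fun G hG => ?_, 1 / 300, by norm_num, fun n hn => ?_⟩
  · have := hG.nonempty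
    exact ⟨asyncAverage_le G, asyncGuaranteed_le hG⟩
  · exact ⟨H_mul_syncAverage_starOn_le hn, syncGuaranteed_starOn_mul_logN_le hn⟩
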